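/- Conventions. A probability measure $\mu$ on $\mathbb{R}$ with finite moments of all orders has moments $m_n(\mu)=\int t^n\,\mu(dt)$, and its free cumulants $(\kappa_n(\mu))_{n\ge 1}$ are determined recursively by $m_n(\mu)=\sum_{\pi\in NC(n)}\prod_{V\in\pi}\kappa_{|V|}(\mu)$, where $NC(n)$ is the set of non-crossing partitions of $\{1,\dots,n\}$. A free additive convolution of two such measures $\mu,\nu$ is a probability measure $\rho$ on $\mathbb{R}$ with finite moments of all orders such that $\kappa_n(\rho)=\kappa_n(\mu)+\kappa_n(\nu)$ for all $n\ge 1$. We write $\mu\boxplus\nu$ for such a measure; if $\mu$ and $\nu$ are compactly supported, it is unique. For a monic polynomial $p(x)=\sum_{k=0}^d(-1)^k a_k x^{d-k}$ of degree $d$ and $1\le n\le d$, the finite free cumulants of $p$ are $$\kappa_n^d(p)=\frac{(-d)^n}{d\,(n-1)!}\sum_{\pi\in P(n)}(-1)^{|\pi|}\,(|\pi|-1)!\prod_{V\in\pi}\frac{|V|!\,a_{|V|}}{(d)_{|V|}},$$ where $P(n)$ is the set of all partitions of $\{1,\dots,n\}$, $|\pi|$ is the number of blocks of $\pi$, and $(d)_k=d(d-1)\cdots(d-k+1)$.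 Let $p_d(\mu)$ be the unique monic polynomial of degree $d$ such that $\kappa_n^d(p_d(\mu))=\kappa_n(\mu)$ for $1\le n\le d$. For an infinite set $S$ of natural numbers, let $\mathcal{M}_{\mathcal R}(S)$ be the set of probability measures $\mu$ on $\mathbb{R}$ with finite moments of all orders such that $p_d(\mu)$ has only real roots for every $d\in S$. Proposition. 1. Let $S_1,S_2$ be sets of natural numbers such that $S=S_1\cap S_2$ is infinite, and let $\mu\in\mathcal{M}_{\mathcal R}(S_1)$ and $\nu\in\mathcal{M}_{\mathcal R}(S_2)$. Then $\mu\boxplus\nu$ exists and $\mu\boxplus\nu\in\mathcal{M}_{\mathcal R}(S)$; if there are several free additive convolutions of $\mu$ and $\nu$, they all belong to $\mathcal{M}_{\mathcal R}(S)$. In particular, for every infinite $S$, $\mathcal{M}_{\mathcal R}(S)$ is closed under $\boxplus$. 2. For every infinite $S$, $\mathcal{M}_{\mathcal R}(S)$ is closed under convergence in moments: if $\mu_k\in\mathcal{M}_{\mathcal R}(S)$ for all $k$, and $\mu$ is a probability measure on $\mathbb{R}$ with finite moments of all orders such that $\lim_{k\to\infty}m_n(\mu_k)=m_n(\mu)$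 for all $n\ge 1$, then $\mu\in\mathcal{M}_{\mathcal R}(S)$. -/

import Mathlib

open MeasureTheory Filter Topology Polynomial

/-- A set partition of `{0, …, n - 1}` is non-crossing if, whenever `i < j < k < l` with `i, k` in a
block `V` and `j, l` in a block `W`, the blocks `V` and `W` coincide. -/
def IsNonCrossing {n : ℕ} (π : Finpartition (Finset.univ : Finset (Fin n))) : Prop :=
  ∀ i j k l : Fin n, i < j → j < k → k < l →
    ∀ V ∈ π.parts, ∀ W ∈ π.parts, i ∈ V → k ∈ V → j ∈ W → l ∈ W → V = W

instance instDecidableIsNonCrossing {n : ℕ} : DecidablePred (IsNonCrossing (n := n)) := fun π => by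
  unfold IsNonCrossing
  infer_instance

/-- `NC(n)`, the finite set of non-crossing partitions of an `n`-element linearly ordered set. -/
def nonCrossingPartitions (n : ℕ) : Finset (Finpartition (Finset.univ : Finset (Fin n))) :=
  Finset.univ.filter IsNonCrossing

/-- `u_π = ∏_{V ∈ π} u_{|V|}`. -/
def partitionProd (u : ℕ → ℝ) {n : ℕ} (π : Finpartition (Finset.univ : Finset (Fin n))) : ℝ :=
  ∏ V ∈ π.parts, u V.card

/-- The free cumulants of a sequence of moments `m`, obtained by solving the moment-cumulant formula
`m_n = ∑_{π ∈ NC(n)} κ_π` for `κ_n`, the contribution of the one-block partition (the only partition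
with a block of size `n`). Only the values at `n ≥ 1` are meaningful. -/
noncomputable def freeCumulantSeq (m : ℕ → ℝ) (n : ℕ) : ℝ :=
  m n - ∑ π ∈ nonCrossingPartitions n,
    if h : ∀ V ∈ π.parts, V.card < n then
      ∏ V ∈ π.parts.attach,
        have : V.1.card < n := h V.1 V.2
        freeCumulantSeq m V.1.card
    else 0
termination_by n

/-- The moment-cumulant formula. -/
theorem moment_eq_sum_nonCrossing (m : ℕ → ℝ) {n : ℕ} (hn : 1 ≤ n) :
    m n = ∑ π ∈ nonCrossingPartitions n, partitionProd (freeCumulantSeq m) π := by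
  have hne : (Finset.univ : Finset (Fin n)) ≠ ⊥ := by
    have : Nonempty (Fin n) := ⟨⟨0, hn⟩⟩
    exact Finset.univ_nonempty.ne_empty
  have htop : Finpartition.indiscrete hne ∈ nonCrossingPartitions n := by
    simp only [nonCrossingPartitions, Finset.mem_filter, Finset.mem_univ, true_and]
    intro i j k l _ _ _ V hV W hW _ _ _ _
    simp only [Finpartition.indiscrete_parts, Finset.mem_singleton] at hV hW
    rw [hV, hW]
  have hother : ∀ π : Finpartition (Finset.univ : Finset (Fin n)),
      π ≠ Finpartition.indiscrete hne → ∀ V ∈ π.parts, V.card < n := by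
    intro π hπ V hV
    by_contra hlt
    apply hπ
    have hVu : V = Finset.univ := by
      rw [← Finset.card_eq_iff_eq_univ, Fintype.card_fin]
      exact le_antisymm (by simpa using Finset.card_le_univ V) (not_lt.mp hlt)
    ext W
    simp only [Finpartition.indiscrete_parts, Finset.mem_singleton]
    constructor
    · intro hW
      by_contra hWV
      have hd := π.disjoint hW hV (by rwa [hVu])
      rw [hVu] at hd
      exact π.ne_bot hW (disjoint_top.mp hd)
    · intro hW
      exact (hW.trans hVu.symm) ▸ hV
  have hrec : freeCumulantSeq m n = m n - ∑ π ∈ nonCrossingPartitions n,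
      if ∀ V ∈ π.parts, V.card < n then partitionProd (freeCumulantSeq m) π else 0 := by
    rw [freeCumulantSeq]
    congr 1
    refine Finset.sum_congr rfl fun π _ => ?_
    by_cases h : ∀ V ∈ π.parts, V.card < n
    · rw [dif_pos h, if_pos h, partitionProd]
      exact Finset.prod_attach π.parts (fun V => freeCumulantSeq m V.card)
    · rw [dif_neg h, if_neg h]
  rw [← Finset.add_sum_erase _ _ htop] at hrec ⊢
  have h0 : ¬ ∀ V ∈ (Finpartition.indiscrete hne).parts, V.card < n := by
    simp [Finpartition.indiscrete_parts]
  have h1 : partitionProd (freeCumulantSeq m) (Finpartition.indiscrete hne)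
      = freeCumulantSeq m n := by
    simp [partitionProd, Finpartition.indiscrete_parts]
  rw [if_neg h0, zero_add, Finset.sum_congr rfl
    (fun π hπ => if_pos (hother π (Finset.ne_of_mem_erase hπ)))] at hrec
  rw [h1, hrec]
  ring

/-- The `n`-th moment of a measure on the real line. -/
noncomputable def realMoment (μ : Measure ℝ) (n : ℕ) : ℝ := ∫ x, x ^ n ∂μ

/-- The `n`-th free cumulant of a measure on the real line. -/
noncomputable def freeCumulant (μ : Measure ℝ) (n : ℕ) : ℝ :=
  freeCumulantSeq (realMoment μ) n

/-- `μ` is a probability measure on the real line with finite moments of all orders. -/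
def HasAllMoments (μ : Measure ℝ) : Prop :=
  IsProbabilityMeasure μ ∧ ∀ n : ℕ, Integrable (fun x : ℝ => x ^ n) μ

/-- For probability measures with finite moments of all orders, `ρ` is a free additive convolution
of `μ` and `ν`: its free cumulants are the sums of those of `μ` and `ν`. -/
def IsFreeAddConv (μ ν ρ : Measure ℝ) : Prop :=
  HasAllMoments ρ ∧ ∀ n : ℕ, 1 ≤ n → freeCumulant ρ n = freeCumulant μ n + freeCumulant ν n

open Classical in
/-- The free additive convolution `μ ⊞ ν`, the probability measure with free cumulants
`κ_n(μ) + κ_n(ν)`; it is unique when `μ` and `ν` have compact support. If there is no such measure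
the value is the zero measure, which is not a probability measure. -/
noncomputable def freeAddConv (μ ν : Measure ℝ) : Measure ℝ :=
  if h : ∃ ρ, IsFreeAddConv μ ν ρ then h.choose else 0

/-- For `p` of degree `d` and `k ≤ d`, the coefficient `a_k` in
`p(x) = ∑_{k = 0}^d (-1)^k a_k x^{d - k}`; if `p` is monic, this is the `k`-th elementary symmetric
polynomial of its roots. -/
noncomputable def signedCoeff (d : ℕ) (p : ℝ[X]) (k : ℕ) : ℝ :=
  (-1) ^ k * p.coeff (d - k)

/-- The finite free cumulant `κ_n^d(p)` of a monic polynomial `p` of degree `d`, for `1 ≤ n ≤ d`: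
`(-d)^n / (d (n-1)!) * ∑_{π ∈ P(n)} (-1)^{|π|} (∏_{V ∈ π} |V|!) a_π (|π|-1)! / (d)_π`, where
`(d)_k = d (d-1) ⋯ (d-k+1)`. -/
noncomputable def finiteFreeCumulant (d : ℕ) (p : ℝ[X]) (n : ℕ) : ℝ :=
  (-(d : ℝ)) ^ n / ((d : ℝ) * ((n - 1).factorial : ℝ)) *
    ∑ π : Finpartition (Finset.univ : Finset (Fin n)),
      (-1) ^ π.parts.card * partitionProd (fun k => (k.factorial : ℝ)) π *
        partitionProd (signedCoeff d p) π * ((π.parts.card - 1).factorial : ℝ) /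
          partitionProd (fun k => (d.descFactorial k : ℝ)) π

/-- `p` is the polynomial `p_d(μ)`: it is monic of degree `d`, and its finite free cumulants are the
first `d` free cumulants of `μ`. These constraints determine `p`. -/
def IsCumulantPolynomial (d : ℕ) (μ : Measure ℝ) (p : ℝ[X]) : Prop :=
  p.Monic ∧ p.natDegree = d ∧
    ∀ n : ℕ, 1 ≤ n → n ≤ d → finiteFreeCumulant d p n = freeCumulant μ n

/-- The set of `S`-real-rooted limits: probability measures `μ` with finite moments of all orders
for which `p_d(μ)` is real-rooted for every `d ∈ S`. -/
def realRootedLimits (S : Set ℕ) : Set (Measure ℝ) :=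
  {μ | HasAllMoments μ ∧ ∀ d ∈ S, ∃ p : ℝ[X], IsCumulantPolynomial d μ p ∧ p.Splits}

/-! Write a monic polynomial of degree d as `∑ b_k (d)_k x^(d-k)` and put `B(s) = ∑ b_k s^k`. The
sum over P(n) with weights `(-1)^|π| (|π|-1)!` is a logarithm in disguise: the finite free cumulants
are κ_1, …, κ_d exactly when `B' = -K B` modulo `s^d`, where `K = ∑ κ_(k+1) d^(-k) s^k`. So `p_d(μ)`
exists, is unique and is explicit (`isCumulantPolynomial_iff`), and adding cumulants multiplies the
series B (`mk_cumulantCoeff_mul`).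

Real roots survive this product. If p and q belong to κ and κ', the polynomial of κ + κ', evaluated
at z and scaled by d!, is the apolar pairing of `q(z - ·)` with p (`apolarPairing_cumulantPoly`).
For real-rooted p, q and Im z > 0, the roots of `q(z - ·)` lie in the open upper half-plane and
those of p on the real line, so Grace's theorem (`apolarPairing_ne_zero`) makes the pairing nonzero.
A real polynomial without roots in the upper half-plane is real-rooted.

For the existence of μ ⊞ ν, put κ = κ(μ) + κ(ν). For d in S the polynomial p of κ is real-rooted, so
its normalized root distribution is a probability measure, with moment series `M = x p' / (d p)` in
s = 1/x. The equation for B becomes `x p' = d (p + ∑ κ_n d^(-n) p^(n))`. After division by d p, the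
n-th term is κ_n s^n M^n up to corrections of order 1/d. In the limit `M = 1 + ∑ κ_n (s M)^n`, which
is the moment-cumulant formula over non-crossing partitions (`coeff_mk_ncNumber`,
`tendsto_coeff_ncNumber`). The root moments therefore converge to the moments determined by κ, and
by tightness these are the moments of a measure (`exists_hasAllMoments_of_tendsto`).

For limits in moments, free cumulants are polynomials in the moments and the coefficients of `p_d`
are polynomials in the cumulants. The bound `|p(z)| ≥ |Im z|^d` for monic real-rooted p
(`abs_im_pow_le_norm_aeval`) passes to the limit and excludes nonreal roots. -/

/-! ### Set partitions as sets of blocks -/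

section SetPartitions

/-- `P` is the set of blocks of a partition of the finite set `s`. -/
def IsSetPartition {α : Type*} (s : Finset α) (P : Finset (Finset α)) : Prop :=
  (∀ V ∈ P, V.Nonempty) ∧ (∀ V ∈ P, V ⊆ s) ∧ (∀ x ∈ s, ∃ V ∈ P, x ∈ V) ∧
    ∀ V ∈ P, ∀ W ∈ P, ∀ x, x ∈ V → x ∈ W → V = W

open Classical in
/-- The partitions of a finite set, as sets of blocks. -/
noncomputable def setPartitions {α : Type*} (s : Finset α) : Finset (Finset (Finset α)) :=
  s.powerset.powerset.filter (IsSetPartition s)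

theorem mem_setPartitions {α : Type*} {s : Finset α} {P : Finset (Finset α)} :
    P ∈ setPartitions s ↔ IsSetPartition s P := by
  classical
  simp only [setPartitions, Finset.mem_filter, Finset.mem_powerset, and_iff_right_iff_imp]
  intro h V hV
  exact Finset.mem_powerset.2 (h.2.1 V hV)

variable {α : Type*} [DecidableEq α]

theorem Finpartition.isSetPartition_parts {s : Finset α} (π : Finpartition s) :
    IsSetPartition s π.parts :=
  ⟨fun _ hV => π.nonempty_of_mem_parts hV, fun _ hV => π.le hV,
    fun _ hx => π.exists_mem hx, fun _ hV _ hW _ hxV hxW => π.eq_of_mem_parts hV hW hxV hxW⟩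

theorem IsSetPartition.exists_finpartition {s : Finset α} {P : Finset (Finset α)}
    (h : IsSetPartition s P) : ∃ π : Finpartition s, π.parts = P :=
  ⟨Finpartition.ofExistsUnique P h.2.1
    (fun a ha => by
      obtain ⟨V, hV, haV⟩ := h.2.2.1 a ha
      exact ⟨V, ⟨hV, haV⟩, fun W hW => h.2.2.2 W hW.1 V hV a hW.2 haV⟩)
    (fun h0 => by simpa using h.1 _ h0), rfl⟩

/-- Bare sets of blocks avoid dependence on the ground set, so blocks can be removed and glued
freely. This lemma carries the sums back to `Finpartition`, both for all partitions and for the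
non-crossing ones. -/
theorem sum_finpartition_filter {M : Type*} [AddCommMonoid M] {s : Finset α}
    (p : Finset (Finset α) → Prop) [DecidablePred p] (f : Finset (Finset α) → M) :
    ∑ π : Finpartition s with p π.parts, f π.parts = ∑ P ∈ setPartitions s with p P, f P := by
  refine Finset.sum_bij (fun π _ => π.parts) ?_ ?_ ?_ ?_
  · intro π hπ
    simp only [Finset.mem_filter, Finset.mem_univ, true_and] at hπ
    simp only [Finset.mem_filter, mem_setPartitions]
    exact ⟨π.isSetPartition_parts, hπ⟩
  · intro π _ π' _ h
    exact Finpartition.ext h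
  · intro P hP
    simp only [Finset.mem_filter, mem_setPartitions] at hP
    obtain ⟨π, rfl⟩ := hP.1.exists_finpartition
    exact ⟨π, by simpa using hP.2, rfl⟩
  · intros; rfl

theorem setPartitions_empty {α : Type*} : setPartitions (∅ : Finset α) = {∅} := by
  ext P
  simp only [mem_setPartitions, Finset.mem_singleton, IsSetPartition]
  constructor
  · intro h
    refine Finset.eq_empty_of_forall_notMem fun V hV => ?_
    obtain ⟨x, hx⟩ := h.1 V hV
    simpa using h.2.1 V hV hx
  · rintro rfl
    simp

/-- Summation over partitions, according to the block of a given element. -/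
theorem sum_setPartitions {M : Type*} [AddCommMonoid M] {s : Finset α} {a : α} (ha : a ∈ s)
    (f : Finset (Finset α) → M) :
    ∑ P ∈ setPartitions s, f P =
      ∑ T ∈ (s.erase a).powerset, ∑ Q ∈ setPartitions ((s.erase a) \ T),
        f (insert (insert a T) Q) := by
  rw [Finset.sum_sigma']
  symm
  have hnot : ∀ T Q, Q ∈ setPartitions ((s.erase a) \ T) → ∀ V ∈ Q, a ∉ V := by
    intro T Q hQ V hV haV
    have := (mem_setPartitions.1 hQ).2.1 V hV haV
    simp at this
  refine Finset.sum_bij (fun x _ => insert (insert a x.1) x.2) ?_ ?_ ?_ ?_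
  · rintro ⟨T, Q⟩ hx
    simp only [Finset.mem_sigma, Finset.mem_powerset] at hx
    obtain ⟨hT, hQ⟩ := hx
    have hn := hnot T Q hQ
    obtain ⟨h1, h2, h3, h4⟩ := mem_setPartitions.1 hQ
    refine mem_setPartitions.2 ⟨?_, ?_, ?_, ?_⟩
    · grind
    · intro V hV
      rcases Finset.mem_insert.1 hV with rfl | hV
      · grind
      · grind
    · intro x hx
      by_cases hxa : x = a
      · grind
      by_cases hxT : x ∈ T
      · grind
      obtain ⟨V, hV, hxV⟩ := h3 x (by grind)
      exact ⟨V, by grind, hxV⟩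
    · have h5 : ∀ V ∈ Q, ∀ x, x ∈ V → x ∉ insert a T := by
        intro V hV x hx
        have := h2 V hV hx
        grind
      intro V hV W hW x hxV hxW
      rcases Finset.mem_insert.1 hV with rfl | hV <;> rcases Finset.mem_insert.1 hW with rfl | hW
      · rfl
      · exact absurd hxV (h5 W hW x hxW)
      · exact absurd hxW (h5 V hV x hxV)
      · exact h4 V hV W hW x hxV hxW
  · rintro ⟨T, Q⟩ hx ⟨T', Q'⟩ hx' h
    simp only [Finset.mem_sigma, Finset.mem_powerset] at hx hx' h
    have hn := hnot T Q hx.2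
    have hn' := hnot T' Q' hx'.2
    have haT : a ∉ T := fun h => by simpa using hx.1 h
    have haT' : a ∉ T' := fun h => by simpa using hx'.1 h
    have h1 : insert a T = insert a T' := by
      have : insert a T ∈ insert (insert a T') Q' := h ▸ Finset.mem_insert_self _ _
      rcases Finset.mem_insert.1 this with h | h
      · exact h
      · exact absurd (Finset.mem_insert_self a T) (hn' _ h)
    have h2 : T = T' := by
      rw [← Finset.erase_insert haT, h1, Finset.erase_insert haT']
    subst h2
    have h3 : Q = Q' := by
      have e : ∀ R : Finset (Finset α), (∀ V ∈ R, a ∉ V) →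
          (insert (insert a T) R).erase (insert a T) = R := by
        intro R hR
        exact Finset.erase_insert fun hm => hR _ hm (Finset.mem_insert_self a T)
      rw [← e Q hn, h, e Q' hn']
    subst h3
    rfl
  · intro P hP
    obtain ⟨h1, h2, h3, h4⟩ := mem_setPartitions.1 hP
    obtain ⟨V, hV, haV⟩ := h3 a ha
    refine ⟨⟨V.erase a, P.erase V⟩, ?_, ?_⟩
    · simp only [Finset.mem_sigma, Finset.mem_powerset]
      refine ⟨Finset.erase_subset_erase _ (h2 V hV), mem_setPartitions.2 ⟨?_, ?_, ?_, ?_⟩⟩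
      · grind
      · intro W hW x hx
        have hW' := Finset.mem_erase.1 hW
        have : x ∉ V := fun hxV => hW'.1 (h4 W hW'.2 V hV x hx hxV)
        have := h2 W hW'.2 hx
        grind
      · intro x hx
        obtain ⟨W, hW, hxW⟩ := h3 x (by grind)
        exact ⟨W, by grind, hxW⟩
      · intro W hW W' hW'
        exact h4 W (Finset.mem_of_mem_erase hW) W' (Finset.mem_of_mem_erase hW')
    · simp only
      rw [Finset.insert_erase haV, Finset.insert_erase hV]
  · intros; rfl

end SetPartitions

/-! ### Recursive decomposition of non-crossing partitions -/

section NonCrossing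

variable {α : Type*} [LinearOrder α]

/-- A set of blocks is non-crossing if no two distinct blocks cross. -/
def NonCrossingBlocks (P : Finset (Finset α)) : Prop :=
  ∀ i j k l : α, i < j → j < k → k < l →
    ∀ V ∈ P, ∀ W ∈ P, i ∈ V → k ∈ V → j ∈ W → l ∈ W → V = W

open Classical in
/-- The non-crossing partitions of a finite subset of a linear order, as sets of blocks. -/
noncomputable def ncPartitions (s : Finset α) : Finset (Finset (Finset α)) :=
  (setPartitions s).filter NonCrossingBlocks

theorem mem_ncPartitions {s : Finset α} {P : Finset (Finset α)} :
    P ∈ ncPartitions s ↔ IsSetPartition s P ∧ NonCrossingBlocks P := by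
  classical
  simp only [ncPartitions, Finset.mem_filter, mem_setPartitions]

/-- The map adding the point `a` to the sets that contain `b`. -/
def attachPoint (a b : α) (V : Finset α) : Finset α := if b ∈ V then insert a V else V

theorem attachPoint_erase {a b : α} {V : Finset α} (h : a ∉ V) :
    (attachPoint a b V).erase a = V := by
  unfold attachPoint; split_ifs <;> simp [h]

theorem mem_attachPoint_self {a b : α} {V : Finset α} (h : a ∉ V) :
    a ∈ attachPoint a b V ↔ b ∈ V := by
  unfold attachPoint; split_ifs with h' <;> simp [h, h']

theorem mem_attachPoint_of_ne {a b x : α} {V : Finset α} (h : x ≠ a) :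
    x ∈ attachPoint a b V ↔ x ∈ V := by
  unfold attachPoint; split_ifs <;> simp [h]

theorem subset_attachPoint {a b : α} {V : Finset α} : V ⊆ attachPoint a b V := by
  unfold attachPoint; split_ifs <;> simp

theorem mem_of_mem_attachPoint {a b x : α} {V : Finset α} (h : x ∈ attachPoint a b V) :
    x = a ∧ b ∈ V ∨ x ∈ V := by
  unfold attachPoint at h; split_ifs at h <;> grind

/-- The blocks of Q lie in the gap between a and b, and all other points except a are at least b, so
blocks of the two families cannot cross. A crossing that uses a as its first point gives one in R
when a is replaced by b, unless the second point is b itself, and then the two blocks share b. -/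
theorem nonCrossing_glue {s : Finset α} {a b : α} (ha : ∀ x ∈ s, a < x) (hb : b ∈ s)
    {Q R : Finset (Finset α)} (hQ : Q ∈ ncPartitions (s.filter (· < b)))
    (hR : R ∈ ncPartitions (s.filter (b ≤ ·))) :
    Q ∪ R.image (attachPoint a b) ∈ ncPartitions (insert a s) := by
  obtain ⟨⟨Q1, Q2, Q3, Q4⟩, Q5⟩ := mem_ncPartitions.1 hQ
  obtain ⟨⟨R1, R2, R3, R4⟩, R5⟩ := mem_ncPartitions.1 hR
  have Q2' : ∀ V ∈ Q, ∀ x ∈ V, x ∈ s ∧ x < b := fun V hV x hx => by simpa using Q2 V hV hx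
  have R2' : ∀ V ∈ R, ∀ x ∈ V, x ∈ s ∧ b ≤ x := fun V hV x hx => by simpa using R2 V hV hx
  have hmem : ∀ V ∈ R, ∀ x ∈ attachPoint a b V, x = a ∧ b ∈ V ∨ (x ∈ V ∧ x ∈ s ∧ b ≤ x ∧ a < x) := by
    intro V hV x hx
    rcases mem_of_mem_attachPoint hx with h | h
    · exact Or.inl h
    · exact Or.inr ⟨h, (R2' V hV x h).1, (R2' V hV x h).2, ha x (R2' V hV x h).1⟩
  have key : ∀ V ∈ Q ∪ R.image (attachPoint a b),
      (V ∈ Q ∧ ∀ x ∈ V, x ∈ s ∧ x < b ∧ a < x) ∨ ∃ W ∈ R, V = attachPoint a b W ∧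
        ∀ x ∈ V, x = a ∧ b ∈ W ∨ (x ∈ W ∧ x ∈ s ∧ b ≤ x ∧ a < x) := by
    intro V hV
    rcases Finset.mem_union.1 hV with hV | hV
    · exact Or.inl ⟨hV, fun x hx => ⟨(Q2' V hV x hx).1, (Q2' V hV x hx).2, ha x (Q2' V hV x hx).1⟩⟩
    · obtain ⟨W, hW, rfl⟩ := Finset.mem_image.1 hV
      exact Or.inr ⟨W, hW, rfl, hmem W hW⟩
  refine mem_ncPartitions.2 ⟨⟨?_, ?_, ?_, ?_⟩, ?_⟩
  · intro V hV
    rcases key V hV with ⟨hV, -⟩ | ⟨W, hW, rfl, -⟩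
    · exact Q1 V hV
    · exact (R1 W hW).mono subset_attachPoint
  · intro V hV x hx
    rcases key V hV with ⟨hV, h⟩ | ⟨W, hW, rfl, h⟩
    · exact Finset.mem_insert_of_mem (h x hx).1
    · rcases h x hx with h | h
      · simp [h.1]
      · simp [h.2.1]
  · intro x hx
    rcases Finset.mem_insert.1 hx with rfl | hx
    · obtain ⟨V, hV, hbV⟩ := R3 b (by simp [hb])
      exact ⟨attachPoint x b V, by grind, by simp [attachPoint, hbV]⟩
    · rcases lt_or_ge x b with h | h
      · obtain ⟨V, hV, hxV⟩ := Q3 x (by simp [hx, h])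
        exact ⟨V, by grind, hxV⟩
      · obtain ⟨V, hV, hxV⟩ := R3 x (by simp [hx, h])
        exact ⟨attachPoint a b V, by grind, subset_attachPoint hxV⟩
  · intro V hV W hW x hxV hxW
    rcases key V hV with ⟨hV, h⟩ | ⟨V₁, hV₁, rfl, h⟩ <;>
      rcases key W hW with ⟨hW, h'⟩ | ⟨W₁, hW₁, rfl, h'⟩
    · exact Q4 V hV W hW x hxV hxW
    · have := h x hxV; have := h' x hxW; grind
    · have := h x hxV; have := h' x hxW; grind
    · congr 1
      rcases h x hxV with h | h <;> rcases h' x hxW with h' | h'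
      · exact R4 V₁ hV₁ W₁ hW₁ b h.2 h'.2
      · exact absurd h.1 h'.2.2.2.ne'
      · exact absurd h'.1 h.2.2.2.ne'
      · exact R4 V₁ hV₁ W₁ hW₁ x h.1 h'.1
  · intro i j k l hij hjk hkl V hV W hW hi hk hj hl
    rcases key V hV with ⟨hV, h⟩ | ⟨V₁, hV₁, rfl, h⟩ <;>
      rcases key W hW with ⟨hW, h'⟩ | ⟨W₁, hW₁, rfl, h'⟩
    · exact Q5 i j k l hij hjk hkl V hV W hW hi hk hj hl
    · have := h i hi; have := h k hk; have := h' j hj; grind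
    · have := h k hk; have := h' l hl; have := h' j hj; grind
    · congr 1
      have haj : a < j := by
        rcases h i hi with h | h
        · exact h.1 ▸ hij
        · exact h.2.2.2.trans hij
      have hj' := (h' j hj).resolve_left (fun e => haj.ne' e.1)
      have hk' := (h k hk).resolve_left (fun e => (haj.trans hjk).ne' e.1)
      have hl' := (h' l hl).resolve_left (fun e => ((haj.trans hjk).trans hkl).ne' e.1)
      rcases h i hi with h | h
      · rcases hj'.2.2.1.eq_or_lt with rfl | hbj
        · exact R4 V₁ hV₁ W₁ hW₁ b h.2 hj'.1
        · exact R5 b j k l hbj hjk hkl V₁ hV₁ W₁ hW₁ h.2 hk'.1 hj'.1 hl'.1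
      · exact R5 i j k l hij hjk hkl V₁ hV₁ W₁ hW₁ h.1 hk'.1 hj'.1 hl'.1

/-- Take for b the element following a in the block of a. Any other block with points on both sides
of b would cross the pair a, b, so the remaining blocks separate into those below b and those above.
-/
theorem exists_nonCrossing_glue {s : Finset α} {a : α} (ha : ∀ x ∈ s, a < x)
    {P : Finset (Finset α)} (hP : P ∈ ncPartitions (insert a s)) (haP : {a} ∉ P) :
    ∃ b ∈ s, ∃ Q ∈ ncPartitions (s.filter (· < b)), ∃ R ∈ ncPartitions (s.filter (b ≤ ·)),
      P = Q ∪ R.image (attachPoint a b) := by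
  obtain ⟨⟨P1, P2, P3, P4⟩, P5⟩ := mem_ncPartitions.1 hP
  obtain ⟨U, hU, haU⟩ := P3 a (Finset.mem_insert_self _ _)
  have has : a ∉ s := fun h => lt_irrefl _ (ha a h)
  have hne : (U.erase a).Nonempty := by
    rw [Finset.nonempty_iff_ne_empty]
    intro h
    have : U = {a} := by
      rw [← Finset.insert_erase haU, h]; rfl
    exact haP (this ▸ hU)
  obtain ⟨b, hb, hbmin⟩ : ∃ b ∈ U.erase a, ∀ x ∈ U.erase a, b ≤ x :=
    ⟨_, Finset.min'_mem _ hne, fun x hx => Finset.min'_le _ x hx⟩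
  have hbU := (Finset.mem_erase.1 hb).2
  have hbs : b ∈ s := by have := P2 U hU hbU; grind
  have hab := ha b hbs
  have hother : ∀ V ∈ P, V ≠ U → (∀ x ∈ V, x ∈ s ∧ x < b) ∨ (∀ x ∈ V, x ∈ s ∧ b ≤ x) := by
    intro V hV hVU
    have hVs : ∀ x ∈ V, x ∈ s := by
      intro x hx
      have hxa : x ≠ a := by
        rintro rfl
        exact hVU (P4 V hV U hU x hx haU)
      have := P2 V hV hx
      grind
    by_contra hcon
    push Not at hcon
    obtain ⟨⟨y, hy, hy'⟩, ⟨x, hx, hx'⟩⟩ := hcon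
    have hxb := hx' (hVs x hx)
    have hby := hy' (hVs y hy)
    have hyb : b ≠ y := by
      rintro rfl
      exact hVU (P4 V hV U hU b hy hbU)
    exact hVU (P5 a x b y (ha x (hVs x hx)) hxb (lt_of_le_of_ne hby hyb) U hU V hV haU hbU hx hy).symm
  classical
  set Q := P.filter (fun V => V ≠ U ∧ ∀ x ∈ V, x ∈ s ∧ x < b) with hQ
  set R₀ := P.filter (fun V => V ≠ U ∧ ∀ x ∈ V, x ∈ s ∧ b ≤ x) with hR₀
  have hR₀b : ∀ V ∈ R₀, b ∉ V := by
    intro V hV hbV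
    have := Finset.mem_filter.1 hV
    exact this.2.1 (P4 V this.1 U hU b hbV hbU)
  have hU' : ∀ x ∈ U.erase a, x ∈ s ∧ b ≤ x := by
    intro x hx
    refine ⟨?_, hbmin x hx⟩
    have := Finset.mem_erase.1 hx
    have := P2 U hU this.2
    grind
  have hR_or : ∀ V ∈ insert (U.erase a) R₀, V = U.erase a ∨ (V ∈ P ∧ V ≠ U ∧ ∀ x ∈ V, x ∈ s ∧ b ≤ x) := by
    intro V hV
    rcases Finset.mem_insert.1 hV with h | h
    · exact Or.inl h
    · exact Or.inr (Finset.mem_filter.1 h)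
  refine ⟨b, hbs, Q, mem_ncPartitions.2 ⟨⟨?_, ?_, ?_, ?_⟩, ?_⟩, insert (U.erase a) R₀,
    mem_ncPartitions.2 ⟨⟨?_, ?_, ?_, ?_⟩, ?_⟩, ?_⟩
  · exact fun V hV => P1 V (Finset.mem_filter.1 hV).1
  · intro V hV x hx
    simpa using (Finset.mem_filter.1 hV).2.2 x hx
  · intro x hx
    simp only [Finset.mem_filter] at hx
    obtain ⟨V, hV, hxV⟩ := P3 x (Finset.mem_insert_of_mem hx.1)
    have hVU : V ≠ U := by
      rintro rfl
      have := hbmin x (Finset.mem_erase.2 ⟨(ha x hx.1).ne', hxV⟩)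
      exact absurd hx.2 (not_lt.2 this)
    refine ⟨V, Finset.mem_filter.2 ⟨hV, hVU, ?_⟩, hxV⟩
    refine (hother V hV hVU).resolve_right fun h => absurd hx.2 (not_lt.2 (h x hxV).2)
  · intro V hV W hW
    exact P4 V (Finset.mem_filter.1 hV).1 W (Finset.mem_filter.1 hW).1
  · intro i j k l hij hjk hkl V hV W hW
    exact P5 i j k l hij hjk hkl V (Finset.mem_filter.1 hV).1 W (Finset.mem_filter.1 hW).1
  · intro V hV
    rcases hR_or V hV with rfl | h
    · exact hne
    · exact P1 V h.1
  · intro V hV x hx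
    rcases hR_or V hV with rfl | h
    · simpa using hU' x hx
    · simpa using h.2.2 x hx
  · intro x hx
    simp only [Finset.mem_filter] at hx
    obtain ⟨V, hV, hxV⟩ := P3 x (Finset.mem_insert_of_mem hx.1)
    by_cases hVU : V = U
    · subst hVU
      exact ⟨V.erase a, Finset.mem_insert_self _ _, Finset.mem_erase.2 ⟨(ha x hx.1).ne', hxV⟩⟩
    · refine ⟨V, Finset.mem_insert_of_mem (Finset.mem_filter.2 ⟨hV, hVU, ?_⟩), hxV⟩
      exact (hother V hV hVU).resolve_left fun h => absurd (h x hxV).2 (not_lt.2 hx.2)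
  · intro V hV W hW x hxV hxW
    rcases hR_or V hV with rfl | h <;> rcases hR_or W hW with rfl | h'
    · rfl
    · exact absurd (P4 W h'.1 U hU x hxW (Finset.mem_of_mem_erase hxV)) h'.2.1
    · exact absurd (P4 V h.1 U hU x hxV (Finset.mem_of_mem_erase hxW)) h.2.1
    · exact P4 V h.1 W h'.1 x hxV hxW
  · intro i j k l hij hjk hkl V hV W hW hi hk hj hl
    rcases hR_or V hV with rfl | h <;> rcases hR_or W hW with rfl | h'
    · rfl
    · exact absurd (P5 i j k l hij hjk hkl U hU W h'.1 (Finset.mem_of_mem_erase hi)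
        (Finset.mem_of_mem_erase hk) hj hl).symm h'.2.1
    · exact absurd (P5 i j k l hij hjk hkl V h.1 U hU hi hk (Finset.mem_of_mem_erase hj)
        (Finset.mem_of_mem_erase hl)) h.2.1
    · exact P5 i j k l hij hjk hkl V h.1 W h'.1 hi hk hj hl
  · have hUa : attachPoint a b (U.erase a) = U := by
      rw [attachPoint, if_pos hb, Finset.insert_erase haU]
    have hRa : ∀ V ∈ R₀, attachPoint a b V = V := fun V hV => by
      rw [attachPoint, if_neg (hR₀b V hV)]
    ext V
    simp only [Finset.mem_union, Finset.mem_image, Finset.mem_insert, exists_eq_or_imp, hUa]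
    constructor
    · intro hV
      by_cases hVU : V = U
      · exact Or.inr (Or.inl hVU.symm)
      rcases hother V hV hVU with h | h
      · exact Or.inl (Finset.mem_filter.2 ⟨hV, hVU, h⟩)
      · have hVR : V ∈ R₀ := Finset.mem_filter.2 ⟨hV, hVU, h⟩
        exact Or.inr (Or.inr ⟨V, hVR, hRa V hVR⟩)
    · rintro (hV | rfl | ⟨W, hW, rfl⟩)
      · exact (Finset.mem_filter.1 hV).1
      · exact hU
      · rw [hRa W hW]
        exact (Finset.mem_filter.1 hW).1

theorem ncPartitions_filter_singleton {s : Finset α} {a : α} (ha : ∀ x ∈ s, a < x)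
    {P : Finset (Finset α)} :
    (P ∈ ncPartitions (insert a s) ∧ {a} ∈ P) ↔ ∃ Q ∈ ncPartitions s, insert {a} Q = P := by
  have has : a ∉ s := fun h => lt_irrefl _ (ha a h)
  constructor
  · rintro ⟨hP, haP⟩
    obtain ⟨⟨P1, P2, P3, P4⟩, P5⟩ := mem_ncPartitions.1 hP
    refine ⟨P.erase {a}, mem_ncPartitions.2 ⟨⟨?_, ?_, ?_, ?_⟩, ?_⟩, Finset.insert_erase haP⟩
    · exact fun V hV => P1 V (Finset.mem_of_mem_erase hV)
    · intro V hV x hx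
      have hV' := Finset.mem_erase.1 hV
      have hxa : x ≠ a := by
        rintro rfl
        exact hV'.1 (P4 V hV'.2 _ haP x hx (Finset.mem_singleton_self _))
      have := P2 V hV'.2 hx
      grind
    · intro x hx
      obtain ⟨V, hV, hxV⟩ := P3 x (Finset.mem_insert_of_mem hx)
      refine ⟨V, Finset.mem_erase.2 ⟨?_, hV⟩, hxV⟩
      rintro rfl
      exact has (Finset.mem_singleton.1 hxV ▸ hx)
    · intro V hV W hW
      exact P4 V (Finset.mem_of_mem_erase hV) W (Finset.mem_of_mem_erase hW)
    · intro i j k l hij hjk hkl V hV W hW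
      exact P5 i j k l hij hjk hkl V (Finset.mem_of_mem_erase hV) W (Finset.mem_of_mem_erase hW)
  · rintro ⟨Q, hQ, rfl⟩
    obtain ⟨⟨Q1, Q2, Q3, Q4⟩, Q5⟩ := mem_ncPartitions.1 hQ
    refine ⟨mem_ncPartitions.2 ⟨⟨?_, ?_, ?_, ?_⟩, ?_⟩, Finset.mem_insert_self _ _⟩
    · grind
    · intro V hV
      rcases Finset.mem_insert.1 hV with rfl | hV
      · simp
      · exact (Q2 V hV).trans (Finset.subset_insert _ _)
    · intro x hx
      rcases Finset.mem_insert.1 hx with rfl | hx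
      · exact ⟨{x}, by simp⟩
      · obtain ⟨V, hV, hxV⟩ := Q3 x hx
        exact ⟨V, Finset.mem_insert_of_mem hV, hxV⟩
    · intro V hV W hW x hxV hxW
      rcases Finset.mem_insert.1 hV with rfl | hV <;> rcases Finset.mem_insert.1 hW with rfl | hW
      · rfl
      · exact absurd (Q2 W hW hxW) (Finset.mem_singleton.1 hxV ▸ has)
      · exact absurd (Q2 V hV hxV) (Finset.mem_singleton.1 hxW ▸ has)
      · exact Q4 V hV W hW x hxV hxW
    · intro i j k l hij hjk hkl V hV W hW hi hk hj hl
      rcases Finset.mem_insert.1 hV with rfl | hV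
      · rw [Finset.mem_singleton] at hi hk
        exact absurd (hij.trans hjk) (by rw [hi, hk]; exact lt_irrefl a)
      rcases Finset.mem_insert.1 hW with rfl | hW
      · rw [Finset.mem_singleton] at hj hl
        exact absurd (hjk.trans hkl) (by rw [hj, hl]; exact lt_irrefl a)
      exact Q5 i j k l hij hjk hkl V hV W hW hi hk hj hl

/-- The sum of `∏ κ_{|V|}` over the non-crossing partitions of `s`. -/
noncomputable def ncSum (κ : ℕ → ℝ) (s : Finset α) : ℝ :=
  ∑ P ∈ ncPartitions s, ∏ V ∈ P, κ V.card

/-- The sum over the non-crossing partitions of `s` in which the block of `a` counts as if it had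
`k` additional elements. -/
noncomputable def ncMarkedSum (κ : ℕ → ℝ) (k : ℕ) (s : Finset α) (a : α) : ℝ :=
  ∑ P ∈ ncPartitions s, ∏ V ∈ P, κ (V.card + if a ∈ V then k else 0)

theorem ncMarkedSum_zero (κ : ℕ → ℝ) (s : Finset α) (a : α) :
    ncMarkedSum κ 0 s a = ncSum κ s := by
  simp [ncMarkedSum, ncSum]

theorem ncSum_empty (κ : ℕ → ℝ) : ncSum κ (∅ : Finset α) = 1 := by
  have : ncPartitions (∅ : Finset α) = {∅} := by
    ext P
    rw [mem_ncPartitions, ← mem_setPartitions, setPartitions_empty, Finset.mem_singleton]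
    refine and_iff_left_of_imp ?_
    rintro rfl
    simp [NonCrossingBlocks]
  simp [ncSum, this]

theorem attachPoint_injOn {s : Finset α} {a : α} (ha : a ∉ s) (b : α) {R : Finset (Finset α)}
    (hR : R ∈ ncPartitions s) : Set.InjOn (attachPoint a b) (R : Set (Finset α)) := by
  intro V hV W hW h
  have h2 := (mem_ncPartitions.1 hR).1.2.1
  rw [← attachPoint_erase (b := b) (fun h' => ha (h2 V hV h')), h,
    attachPoint_erase (fun h' => ha (h2 W hW h'))]

/-- Moving a into the block of b costs that block one element, so a mark k on the block of a becomes
a mark k + 1 on the block of b. This is the reason for introducing marked sums. -/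
theorem prod_glue {s : Finset α} {a b : α} (ha : ∀ x ∈ s, a < x) (κ : ℕ → ℝ) (k : ℕ)
    {Q R : Finset (Finset α)} (hQ : Q ∈ ncPartitions (s.filter (· < b)))
    (hR : R ∈ ncPartitions (s.filter (b ≤ ·))) :
    ∏ V ∈ Q ∪ R.image (attachPoint a b), κ (V.card + if a ∈ V then k else 0) =
      (∏ V ∈ Q, κ V.card) * ∏ V ∈ R, κ (V.card + if b ∈ V then k + 1 else 0) := by
  have has : a ∉ s := fun h => lt_irrefl _ (ha a h)
  obtain ⟨⟨Q1, Q2, Q3, Q4⟩, Q5⟩ := mem_ncPartitions.1 hQ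
  obtain ⟨⟨R1, R2, R3, R4⟩, R5⟩ := mem_ncPartitions.1 hR
  rw [Finset.prod_union]
  · congr 1
    · refine Finset.prod_congr rfl fun V hV => ?_
      rw [if_neg, add_zero]
      exact fun h => has (Finset.mem_filter.1 (Q2 V hV h)).1
    · rw [Finset.prod_image (attachPoint_injOn (by simp [has]) b hR)]
      refine Finset.prod_congr rfl fun V hV => ?_
      have haV : a ∉ V := fun h => has (Finset.mem_filter.1 (R2 V hV h)).1
      by_cases hb : b ∈ V
      · rw [if_pos ((mem_attachPoint_self haV).2 hb), if_pos hb, attachPoint, if_pos hb,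
          Finset.card_insert_of_notMem haV]
        congr 1
        ring
      · rw [if_neg (fun h => hb ((mem_attachPoint_self haV).1 h)), if_neg hb, attachPoint,
          if_neg hb]
  · rw [Finset.disjoint_left]
    intro V hV hV'
    obtain ⟨W, hW, rfl⟩ := Finset.mem_image.1 hV'
    obtain ⟨x, hx⟩ := R1 W hW
    have h1 := Q2 _ hV (subset_attachPoint hx)
    have h2 := R2 W hW hx
    simp only [Finset.mem_filter] at h1 h2
    exact absurd h1.2 (not_lt.2 h2.2)

/-- The point b is recovered as the least element other than a in the block of a. Only one-sided
conclusions are proved; applying them again with the roles exchanged gives equality. -/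
theorem glue_injective {s : Finset α} {a b b' : α} (ha : ∀ x ∈ s, a < x) (hb : b ∈ s) (hb' : b' ∈ s)
    {Q R Q' R' : Finset (Finset α)} (hQ : Q ∈ ncPartitions (s.filter (· < b)))
    (hR : R ∈ ncPartitions (s.filter (b ≤ ·))) (hQ' : Q' ∈ ncPartitions (s.filter (· < b')))
    (hR' : R' ∈ ncPartitions (s.filter (b' ≤ ·)))
    (h : Q ∪ R.image (attachPoint a b) = Q' ∪ R'.image (attachPoint a b')) :
    b' ≤ b ∧ (b = b' → Q ⊆ Q' ∧ R ⊆ R') := by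
  have has : a ∉ s := fun h => lt_irrefl _ (ha a h)
  obtain ⟨⟨Q1, Q2, Q3, Q4⟩, Q5⟩ := mem_ncPartitions.1 hQ
  obtain ⟨⟨R1, R2, R3, R4⟩, R5⟩ := mem_ncPartitions.1 hR
  obtain ⟨⟨Q1', Q2', Q3', Q4'⟩, Q5'⟩ := mem_ncPartitions.1 hQ'
  obtain ⟨⟨R1', R2', R3', R4'⟩, R5'⟩ := mem_ncPartitions.1 hR'
  constructor
  · obtain ⟨V, hV, hbV⟩ := R3 b (by simp [hb])
    have hmem : attachPoint a b V ∈ Q' ∪ R'.image (attachPoint a b') := by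
      rw [← h]; exact Finset.mem_union_right _ (Finset.mem_image_of_mem _ hV)
    have haV : a ∉ V := fun h => has (Finset.mem_filter.1 (R2 V hV h)).1
    have ha' : a ∈ attachPoint a b V := (mem_attachPoint_self haV).2 hbV
    rcases Finset.mem_union.1 hmem with hm | hm
    · exact absurd (Finset.mem_filter.1 (Q2' _ hm ha')).1 has
    · obtain ⟨W, hW, hWV⟩ := Finset.mem_image.1 hm
      have hbW : b ∈ attachPoint a b' W := hWV ▸ subset_attachPoint hbV
      rw [mem_attachPoint_of_ne (ha b hb).ne'] at hbW
      exact (Finset.mem_filter.1 (R2' W hW hbW)).2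
  · rintro rfl
    constructor
    · intro V hV
      have hmem : V ∈ Q' ∪ R'.image (attachPoint a b) := h ▸ Finset.mem_union_left _ hV
      refine (Finset.mem_union.1 hmem).resolve_right fun hm => ?_
      obtain ⟨W, hW, rfl⟩ := Finset.mem_image.1 hm
      obtain ⟨x, hx⟩ := R1' W hW
      have h1 := Finset.mem_filter.1 (Q2 _ hV (subset_attachPoint hx))
      have h2 := Finset.mem_filter.1 (R2' W hW hx)
      exact absurd h1.2 (not_lt.2 h2.2)
    · intro V hV
      have hmem : attachPoint a b V ∈ Q' ∪ R'.image (attachPoint a b) := by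
        rw [← h]; exact Finset.mem_union_right _ (Finset.mem_image_of_mem _ hV)
      have haV : a ∉ V := fun h => has (Finset.mem_filter.1 (R2 V hV h)).1
      rcases Finset.mem_union.1 hmem with hm | hm
      · obtain ⟨x, hx⟩ := R1 V hV
        have h1 := Finset.mem_filter.1 (Q2' _ hm (subset_attachPoint hx))
        have h2 := Finset.mem_filter.1 (R2 V hV hx)
        exact absurd h1.2 (not_lt.2 h2.2)
      · obtain ⟨W, hW, hWV⟩ := Finset.mem_image.1 hm
        have haW : a ∉ W := fun h => has (Finset.mem_filter.1 (R2' W hW h)).1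
        have : W = V := by
          rw [← attachPoint_erase (b := b) haW, hWV, attachPoint_erase haV]
        exact this ▸ hW

/-- Either a is a singleton block, which gives the first term, or its block has a next element b. In
the second case the points below b are partitioned independently of those from b on. -/
theorem ncMarkedSum_insert {s : Finset α} {a : α} (ha : ∀ x ∈ s, a < x) (κ : ℕ → ℝ) (k : ℕ) :
    ncMarkedSum κ k (insert a s) a = κ (k + 1) * ncSum κ s +
      ∑ b ∈ s, ncSum κ (s.filter (· < b)) * ncMarkedSum κ (k + 1) (s.filter (b ≤ ·)) b := by
  classical
  have has : a ∉ s := fun h => lt_irrefl _ (ha a h)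
  rw [ncMarkedSum, ← Finset.sum_filter_add_sum_filter_not _ (fun P => {a} ∈ P)]
  congr 1
  · rw [ncSum, Finset.mul_sum]
    have hnot : ∀ Q ∈ ncPartitions s, ∀ V ∈ Q, a ∉ V := fun Q hQ V hV h =>
      has ((mem_ncPartitions.1 hQ).1.2.1 V hV h)
    have hnot' : ∀ Q ∈ ncPartitions s, {a} ∉ Q := fun Q hQ h =>
      hnot Q hQ _ h (Finset.mem_singleton_self a)
    symm
    refine Finset.sum_bij (fun Q _ => insert {a} Q) ?_ ?_ ?_ ?_
    · intro Q hQ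
      exact Finset.mem_filter.2 ((ncPartitions_filter_singleton ha).2 ⟨Q, hQ, rfl⟩)
    · intro Q hQ Q' hQ' h
      rw [← Finset.erase_insert (hnot' Q hQ), h, Finset.erase_insert (hnot' Q' hQ')]
    · intro P hP
      obtain ⟨Q, hQ, h⟩ := (ncPartitions_filter_singleton ha).1 (Finset.mem_filter.1 hP)
      exact ⟨Q, hQ, h⟩
    · intro Q hQ
      rw [Finset.prod_insert (hnot' Q hQ), Finset.card_singleton,
        if_pos (Finset.mem_singleton_self a), add_comm 1 k]
      congr 1
      refine Finset.prod_congr rfl fun V hV => ?_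
      rw [if_neg (hnot Q hQ V hV), add_zero]
  · have : ∀ b ∈ s, ncSum κ (s.filter (· < b)) * ncMarkedSum κ (k + 1) (s.filter (b ≤ ·)) b =
        ∑ x ∈ ncPartitions (s.filter (· < b)) ×ˢ ncPartitions (s.filter (b ≤ ·)),
          (∏ V ∈ x.1, κ V.card) * ∏ V ∈ x.2, κ (V.card + if b ∈ V then k + 1 else 0) := by
      intro b _
      rw [ncSum, ncMarkedSum, Finset.sum_mul_sum, Finset.sum_product]
    rw [Finset.sum_congr rfl this, Finset.sum_sigma']
    symm
    refine Finset.sum_bij (fun x _ => x.2.1 ∪ x.2.2.image (attachPoint a x.1)) ?_ ?_ ?_ ?_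
    · rintro ⟨b, Q, R⟩ hx
      simp only [Finset.mem_sigma, Finset.mem_product] at hx
      obtain ⟨hb, hQ, hR⟩ := hx
      refine Finset.mem_filter.2 ⟨nonCrossing_glue ha hb hQ hR, fun hm => ?_⟩
      rcases Finset.mem_union.1 hm with hm | hm
      · have := (mem_ncPartitions.1 hQ).1.2.1 _ hm (Finset.mem_singleton_self a)
        exact has (Finset.mem_filter.1 this).1
      · obtain ⟨W, hW, hWa⟩ := Finset.mem_image.1 hm
        have hWs := (mem_ncPartitions.1 hR).1.2.1 W hW
        obtain ⟨x, hx⟩ := (mem_ncPartitions.1 hR).1.1 W hW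
        have hxa : x ∈ ({a} : Finset α) := hWa ▸ subset_attachPoint hx
        exact has (Finset.mem_singleton.1 hxa ▸ (Finset.mem_filter.1 (hWs hx)).1)
    · rintro ⟨b, Q, R⟩ hx ⟨b', Q', R'⟩ hx' h
      simp only [Finset.mem_sigma, Finset.mem_product] at hx hx' h
      obtain ⟨hb, hQ, hR⟩ := hx
      obtain ⟨hb', hQ', hR'⟩ := hx'
      obtain ⟨h1, h2⟩ := glue_injective ha hb hb' hQ hR hQ' hR' h
      obtain ⟨h1', h2'⟩ := glue_injective ha hb' hb hQ' hR' hQ hR h.symm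
      obtain rfl := le_antisymm h1' h1
      obtain rfl := (h2 rfl).1.antisymm (h2' rfl).1
      obtain rfl := (h2 rfl).2.antisymm (h2' rfl).2
      rfl
    · intro P hP
      obtain ⟨hP, haP⟩ := Finset.mem_filter.1 hP
      obtain ⟨b, hb, Q, hQ, R, hR, h⟩ := exists_nonCrossing_glue ha hP haP
      exact ⟨⟨b, Q, R⟩, by simp [hb, hQ, hR], h.symm⟩
    · rintro ⟨b, Q, R⟩ hx
      simp only [Finset.mem_sigma, Finset.mem_product] at hx
      exact (prod_glue ha κ k hx.2.1 hx.2.2).symm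

end NonCrossing

/-! ### The functional equation between moments and free cumulants -/

section NonCrossingSeries

/-- The value of `ncMarkedSum` on a set with `n` elements. -/
noncomputable def ncNumber (κ : ℕ → ℝ) : ℕ → ℕ → ℝ
  | 0, _ => 1
  | n + 1, k => κ (k + 1) * ncNumber κ n 0 +
      ∑ j : Fin n, ncNumber κ j 0 * ncNumber κ (n - j) (k + 1)
termination_by n _ => n

theorem ncNumber_zero (κ : ℕ → ℝ) (k : ℕ) : ncNumber κ 0 k = 1 := by
  rw [ncNumber]

theorem ncNumber_succ (κ : ℕ → ℝ) (n k : ℕ) :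
    ncNumber κ (n + 1) k = κ (k + 1) * ncNumber κ n 0 +
      ∑ j ∈ Finset.range n, ncNumber κ j 0 * ncNumber κ (n - j) (k + 1) := by
  rw [ncNumber, Finset.sum_range]

theorem sum_card_filter_lt {α M : Type*} [LinearOrder α] [AddCommMonoid M] (g : ℕ → M)
    (s : Finset α) :
    ∑ b ∈ s, g (s.filter (· < b)).card = ∑ j ∈ Finset.range s.card, g j := by
  classical
  induction s using Finset.induction_on_max with
  | empty => simp
  | insert a s h ih =>
    have has : a ∉ s := fun h' => lt_irrefl _ (h a h')
    rw [Finset.sum_insert has, Finset.card_insert_of_notMem has, Finset.sum_range_succ, ← ih,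
      add_comm]
    congr 1
    · refine Finset.sum_congr rfl fun b hb => ?_
      rw [Finset.filter_insert, if_neg (h b hb).not_gt]
    · rw [Finset.filter_insert, if_neg (lt_irrefl a), Finset.filter_true_of_mem h]

/-- The recursion mixes unmarked sums with sums marked at the minimum, so the two statements are
proved by one induction on the size, for all marks at once. -/
theorem ncSum_eq_ncNumber {α : Type*} [LinearOrder α] (κ : ℕ → ℝ) (n : ℕ) :
    (∀ s : Finset α, s.card = n → ncSum κ s = ncNumber κ n 0) ∧
    ∀ (k : ℕ) (s : Finset α) (a : α), a ∈ s → (∀ x ∈ s, a ≤ x) → s.card = n →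
      ncMarkedSum κ k s a = ncNumber κ n k := by
  induction n using Nat.strong_induction_on with
  | _ n ih =>
  have key : ∀ (k : ℕ) (s : Finset α) (a : α), a ∈ s → (∀ x ∈ s, a ≤ x) → s.card = n →
      ncMarkedSum κ k s a = ncNumber κ n k := by
    intro k s a ha hmin hcard
    obtain ⟨m, rfl⟩ : ∃ m, n = m + 1 :=
      ⟨n - 1, by have := Finset.card_pos.2 ⟨a, ha⟩; omega⟩
    have hcard' : (s.erase a).card = m := by
      rw [Finset.card_erase_of_mem ha, hcard]; rfl
    have hlt : ∀ x ∈ s.erase a, a < x := fun x hx =>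
      lt_of_le_of_ne (hmin x (Finset.mem_of_mem_erase hx)) (Finset.ne_of_mem_erase hx).symm
    rw [← Finset.insert_erase ha, ncMarkedSum_insert hlt, ncNumber_succ,
      (ih m (Nat.lt_succ_self m)).1 _ hcard']
    congr 1
    rw [← hcard', ← sum_card_filter_lt
      (fun j => ncNumber κ j 0 * ncNumber κ ((s.erase a).card - j) (k + 1)) (s.erase a)]
    refine Finset.sum_congr rfl fun b hb => ?_
    have hadd := Finset.card_filter_add_card_filter_not (s := s.erase a) (fun x => x < b)
    simp only [not_lt] at hadd
    have hpos : 0 < ((s.erase a).filter (b ≤ ·)).card :=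
      Finset.card_pos.2 ⟨b, by simpa using hb⟩
    have hsub : ((s.erase a).filter (b ≤ ·)).card =
        (s.erase a).card - ((s.erase a).filter (· < b)).card := by omega
    rw [(ih _ (by omega)).1 _ rfl, (ih _ (by omega)).2 (k + 1) _ b (by simpa using hb)
      (fun x hx => (Finset.mem_filter.1 hx).2) hsub]
  refine ⟨fun s hs => ?_, key⟩
  rcases s.eq_empty_or_nonempty with rfl | hne
  · rw [Finset.card_empty] at hs
    rw [← hs, ncSum_empty, ncNumber_zero]
  · rw [← ncMarkedSum_zero κ s (s.min' hne)]
    exact key 0 s _ (s.min'_mem hne) (fun x hx => s.min'_le x hx) hs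

theorem sum_nonCrossingPartitions (κ : ℕ → ℝ) (n : ℕ) :
    ∑ π ∈ nonCrossingPartitions n, partitionProd κ π = ncNumber κ n 0 := by
  classical
  rw [← (ncSum_eq_ncNumber κ n).1 (Finset.univ : Finset (Fin n)) (by simp), ncSum, ncPartitions,
    ← sum_finpartition_filter NonCrossingBlocks (fun P => ∏ V ∈ P, κ V.card)]
  refine Finset.sum_congr ?_ fun _ _ => rfl
  ext π
  simp only [nonCrossingPartitions, Finset.mem_filter, Finset.mem_univ, true_and]
  rfl

theorem coeff_mk_ncNumber (κ : ℕ → ℝ) (m : ℕ) :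
    ncNumber κ m 0 = (if m = 0 then 1 else 0) +
      ∑ n ∈ Finset.Icc 1 m, κ n * PowerSeries.coeff (m - n) (PowerSeries.mk (fun i => ncNumber κ i 0) ^ n) := by
  set C : PowerSeries ℝ := PowerSeries.mk fun i => ncNumber κ i 0 with hC
  -- `ncNumber` has the value 1 at size 0 for every mark, but the recursion only meets marked sets
  -- that are nonempty; hence the constant term is removed.
  let T : ℕ → PowerSeries ℝ := fun k => PowerSeries.mk fun n => if n = 0 then 0 else ncNumber κ n k
  have hT : ∀ k, T k = PowerSeries.X * (PowerSeries.C (κ (k + 1)) * C + C * T (k + 1)) := by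
    intro k
    ext n
    cases n with
    | zero => simp [T]
    | succ n =>
      rw [PowerSeries.coeff_succ_X_mul, map_add, PowerSeries.coeff_C_mul, PowerSeries.coeff_mul,
        Finset.Nat.sum_antidiagonal_eq_sum_range_succ
          (fun i j => PowerSeries.coeff i C * PowerSeries.coeff j (T (k + 1))), Finset.sum_range_succ]
      simp only [T, hC, PowerSeries.coeff_mk, if_neg (Nat.succ_ne_zero n), ncNumber_succ, Nat.sub_self, if_true,
        mul_zero, add_zero]
      congr 1
      refine Finset.sum_congr rfl fun j hj => ?_
      rw [if_neg]
      have := Finset.mem_range.1 hj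
      omega
  have hC0 : C = 1 + T 0 := by
    ext n
    cases n <;> simp [hC, T, PowerSeries.coeff_one, ncNumber_zero]
  -- Unfolding `hT` N times replaces the growing mark by powers of X C. The remainder `(X C)^N T N`
  -- has order greater than N, because `T N` has no constant term, so N = m suffices for coefficient
  -- m.
  have hind : ∀ N, T 0 = ∑ n ∈ Finset.Icc 1 N, PowerSeries.C (κ n) * (PowerSeries.X * C) ^ n +
      (PowerSeries.X * C) ^ N * T N := by
    intro N
    induction N with
    | zero => simp
    | succ N ih =>
      rw [ih, Finset.sum_Icc_succ_top (by omega)]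
      conv_lhs => rw [hT N]
      ring
  have h1 : ncNumber κ m 0 = PowerSeries.coeff m C := by simp [hC]
  rw [h1]
  conv_lhs => rw [hC0, hind m]
  rw [map_add, map_add, PowerSeries.coeff_one, map_sum]
  congr 1
  have h0 : PowerSeries.coeff m ((PowerSeries.X * C) ^ m * T m) = 0 := by
    rw [mul_pow, mul_assoc, PowerSeries.coeff_X_pow_mul', if_pos le_rfl, Nat.sub_self]
    simp [T]
  rw [h0, add_zero]
  refine Finset.sum_congr rfl fun n hn => ?_
  rw [PowerSeries.coeff_C_mul, mul_pow, PowerSeries.coeff_X_pow_mul', if_pos (Finset.mem_Icc.1 hn).2]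

/-- The coefficientwise form of `M(z) = 1 + ∑ κ_n (z M(z)) ^ n`. -/
theorem moment_eq_sum_freeCumulantSeq (m : ℕ → ℝ) (h0 : m 0 = 1) {n : ℕ} (hn : 1 ≤ n) :
    m n = ∑ k ∈ Finset.Icc 1 n,
      freeCumulantSeq m k * PowerSeries.coeff (n - k) (PowerSeries.mk m ^ k) := by
  have hm : m = fun i => ncNumber (freeCumulantSeq m) i 0 := by
    funext i
    rcases Nat.eq_zero_or_pos i with rfl | hi
    · rw [h0, ncNumber_zero]
    · rw [← sum_nonCrossingPartitions, ← moment_eq_sum_nonCrossing m hi]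
  have := coeff_mk_ncNumber (freeCumulantSeq m) n
  rw [← hm, if_neg (by omega), zero_add] at this
  rw [← this]
  exact congrFun hm n

/-- The term k = n of the functional equation has coefficient `m 0 ^ n = 1`. Isolating it gives a
triangular recursion, from which both uniqueness and continuity of the cumulants follow. -/
theorem freeCumulantSeq_eq (m : ℕ → ℝ) (h0 : m 0 = 1) {n : ℕ} (hn : 1 ≤ n) :
    freeCumulantSeq m n = m n - ∑ k ∈ Finset.Ico 1 n,
      freeCumulantSeq m k * PowerSeries.coeff (n - k) (PowerSeries.mk m ^ k) := by
  have h := moment_eq_sum_freeCumulantSeq m h0 hn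
  obtain ⟨n, rfl⟩ : ∃ j, n = j + 1 := ⟨n - 1, by omega⟩
  rw [Finset.sum_Icc_succ_top (by omega), Nat.sub_self, PowerSeries.coeff_zero_eq_constantCoeff_apply, map_pow,
    ← PowerSeries.coeff_zero_eq_constantCoeff_apply, PowerSeries.coeff_mk, h0, one_pow, mul_one] at h
  have : Finset.Icc 1 n = Finset.Ico 1 (n + 1) := by ext; simp
  rw [this] at h
  linarith

theorem freeCumulantSeq_ncNumber (κ : ℕ → ℝ) {n : ℕ} (hn : 1 ≤ n) :
    freeCumulantSeq (fun i => ncNumber κ i 0) n = κ n := by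
  induction n using Nat.strong_induction_on with
  | _ n ih =>
  have h := freeCumulantSeq_eq (fun i => ncNumber κ i 0) (ncNumber_zero κ 0) hn
  have h' := coeff_mk_ncNumber κ n
  obtain ⟨n, rfl⟩ : ∃ j, n = j + 1 := ⟨n - 1, by omega⟩
  have hIcc : Finset.Icc 1 n = Finset.Ico 1 (n + 1) := by ext; simp
  rw [Finset.sum_Icc_succ_top (by omega), hIcc, Nat.sub_self,
    PowerSeries.coeff_zero_eq_constantCoeff_apply, map_pow,
    ← PowerSeries.coeff_zero_eq_constantCoeff_apply, PowerSeries.coeff_mk, ncNumber_zero, one_pow,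
    mul_one, if_neg (by omega), zero_add] at h'
  rw [Finset.sum_congr rfl fun k hk => by
    rw [ih k (Finset.mem_Ico.1 hk).2 (Finset.mem_Ico.1 hk).1]] at h
  linarith

end NonCrossingSeries

/-! ### Exponential generating functions and the logarithm -/

section PartitionSeries

/-- The sum over all partitions of a set with `n` elements of `G |π| ∏ u_{|V|}`. -/
noncomputable def partitionNumber (u : ℕ → ℝ) : ℕ → (ℕ → ℝ) → ℝ
  | 0, G => G 0
  | n + 1, G => ∑ j : Fin (n + 1), (n.choose j : ℝ) *
      (u (j + 1) * partitionNumber u (n - j) (fun r => G (r + 1)))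
termination_by n _ => n

theorem partitionNumber_zero (u G : ℕ → ℝ) : partitionNumber u 0 G = G 0 := by
  rw [partitionNumber]

theorem partitionNumber_succ (u G : ℕ → ℝ) (n : ℕ) :
    partitionNumber u (n + 1) G = ∑ j ∈ Finset.range (n + 1), (n.choose j : ℝ) *
      (u (j + 1) * partitionNumber u (n - j) (fun r => G (r + 1))) := by
  rw [partitionNumber, Finset.sum_range]

/-- Removing the block of one chosen point lowers the number of blocks by one, which is the shift of
G in the recursion. -/
theorem sum_setPartitions_eq_partitionNumber {α : Type*} [DecidableEq α] (u G : ℕ → ℝ)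
    (s : Finset α) :
    ∑ P ∈ setPartitions s, G P.card * ∏ V ∈ P, u V.card = partitionNumber u s.card G := by
  induction hn : s.card using Nat.strong_induction_on generalizing s G with
  | _ n ih =>
  rcases s.eq_empty_or_nonempty with rfl | ⟨a, ha⟩
  · rw [← hn, Finset.card_empty, partitionNumber_zero, setPartitions_empty]
    simp
  · obtain ⟨m, rfl⟩ : ∃ m, n = m + 1 :=
      ⟨n - 1, by have := Finset.card_pos.2 ⟨a, ha⟩; omega⟩
    have hcard : (s.erase a).card = m := by
      rw [Finset.card_erase_of_mem ha, hn]; rfl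
    rw [sum_setPartitions ha, partitionNumber_succ]
    have hinner : ∀ T ∈ (s.erase a).powerset,
        ∑ Q ∈ setPartitions ((s.erase a) \ T), G (insert (insert a T) Q).card *
          ∏ V ∈ insert (insert a T) Q, u V.card =
        u (T.card + 1) * partitionNumber u (m - T.card) (fun r => G (r + 1)) := by
      intro T hT
      have hT' := Finset.mem_powerset.1 hT
      have haT : a ∉ T := fun h => by simpa using hT' h
      have hle := Finset.card_le_card hT'
      have hsd : ((s.erase a) \ T).card = m - T.card := by
        rw [Finset.card_sdiff_of_subset hT', hcard]
      rw [← ih (m - T.card) (by omega) _ _ hsd, Finset.mul_sum]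
      refine Finset.sum_congr rfl fun Q hQ => ?_
      have hnot : insert a T ∉ Q := by
        intro h
        have := (mem_setPartitions.1 hQ).2.1 _ h (Finset.mem_insert_self a T)
        simp at this
      rw [Finset.card_insert_of_notMem hnot, Finset.prod_insert hnot,
        Finset.card_insert_of_notMem haT]
      ring
    rw [Finset.sum_congr rfl hinner, Finset.sum_powerset_apply_card
      (fun j => u (j + 1) * partitionNumber u (m - j) (fun r => G (r + 1))), hcard]
    simp only [nsmul_eq_mul]

/-- The exponential generating function of `partitionNumber`. -/
noncomputable def partitionSeries (u G : ℕ → ℝ) : PowerSeries ℝ :=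
  PowerSeries.mk fun n => partitionNumber u n G / n.factorial

/-- This is the chain rule for `∑ G(r) U^r / r!`, where U is the exponential series of u without its
constant term: differentiation produces U' and shifts G. -/
theorem derivative_partitionSeries (u G : ℕ → ℝ) :
    PowerSeries.derivative ℝ (partitionSeries u G) =
      PowerSeries.derivative ℝ (PowerSeries.mk fun n => u n / n.factorial) *
        partitionSeries u (fun r => G (r + 1)) := by
  ext n
  rw [PowerSeries.coeff_derivative, PowerSeries.coeff_mul,
    Finset.Nat.sum_antidiagonal_eq_sum_range_succ
      (fun i j => PowerSeries.coeff i (PowerSeries.derivative ℝ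
        (PowerSeries.mk fun n => u n / n.factorial)) *
        PowerSeries.coeff j (partitionSeries u (fun r => G (r + 1)))),
    partitionSeries, PowerSeries.coeff_mk, partitionNumber_succ, Finset.sum_div, Finset.sum_mul]
  refine Finset.sum_congr rfl fun j hj => ?_
  have hj' : j ≤ n := by simpa [Nat.lt_succ_iff] using hj
  rw [PowerSeries.coeff_derivative, PowerSeries.coeff_mk, partitionSeries, PowerSeries.coeff_mk,
    Nat.cast_choose ℝ hj', Nat.factorial_succ, Nat.factorial_succ]
  have := Nat.factorial_pos n
  have := Nat.factorial_pos j
  have := Nat.factorial_pos (n - j)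
  push_cast
  field_simp

/-- Coefficient n + 1 of a member depends only on coefficients up to n of the next member, so the
constant terms determine the whole family. -/
theorem PowerSeries.eq_of_derivative_eq_mul_succ (U : PowerSeries ℝ) (F F' : ℕ → PowerSeries ℝ)
    (hF : ∀ k, PowerSeries.derivative ℝ (F k) = U * F (k + 1))
    (hF' : ∀ k, PowerSeries.derivative ℝ (F' k) = U * F' (k + 1))
    (h0 : ∀ k, PowerSeries.coeff 0 (F k) = PowerSeries.coeff 0 (F' k)) : F = F' := by
  have : ∀ n k, PowerSeries.coeff n (F k) = PowerSeries.coeff n (F' k) := by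
    intro n
    induction n using Nat.strong_induction_on with
    | _ n ih =>
    intro k
    cases n with
    | zero => exact h0 k
    | succ n =>
      have h : PowerSeries.coeff n (PowerSeries.derivative ℝ (F k)) =
          PowerSeries.coeff n (PowerSeries.derivative ℝ (F' k)) := by
        rw [hF, hF', PowerSeries.coeff_mul, PowerSeries.coeff_mul]
        refine Finset.sum_congr rfl fun x hx => ?_
        have := Finset.HasAntidiagonal.mem_antidiagonal.1 hx
        rw [ih x.2 (by omega)]
      rw [PowerSeries.coeff_derivative, PowerSeries.coeff_derivative] at h
      exact mul_right_cancel₀ (by positivity) h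
  funext k
  ext n
  exact this n k

/-- The partition sum with weights `(-1) ^ |π| (|π| - 1)!` is minus the logarithm. -/
theorem mul_derivative_partitionSeries (u : ℕ → ℝ) (h0 : u 0 = 1) :
    (PowerSeries.mk fun n => u n / n.factorial) *
      PowerSeries.derivative ℝ (partitionSeries u fun r => (-1) ^ r * (r - 1).factorial) =
    -PowerSeries.derivative ℝ (PowerSeries.mk fun n => u n / n.factorial) := by
  set B : PowerSeries ℝ := PowerSeries.mk fun n => u n / n.factorial with hB
  have hB0 : PowerSeries.constantCoeff B = 1 := by
    rw [← PowerSeries.coeff_zero_eq_constantCoeff_apply]; simp [hB, h0]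
  have hinv : B * B⁻¹ = 1 := PowerSeries.mul_inv_cancel B (by rw [hB0]; exact one_ne_zero)
  -- The weights `(-1)^r r!` give the geometric series 1/B. Shifting them k times gives the k-th
  -- derivative of 1/t at t = B, and this family is closed under the chain rule.
  have hfam := PowerSeries.eq_of_derivative_eq_mul_succ (PowerSeries.derivative ℝ B)
    (fun k => partitionSeries u fun r => (-1) ^ (r + k) * (r + k).factorial)
    (fun k => PowerSeries.C ((-1) ^ k * (k.factorial : ℝ)) * B⁻¹ ^ (k + 1)) ?_ ?_ ?_
  · have h1 := congrFun hfam 0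
    simp only [add_zero, pow_zero, Nat.factorial_zero, Nat.cast_one, mul_one, map_one, zero_add,
      pow_one, one_mul] at h1
    -- After one shift the weight `(-1)^r (r-1)!` becomes `-(-1)^r r!`. The truncated value at r = 0
    -- affects only a constant term, which the derivative discards.
    have h2 : (partitionSeries u fun r => (-1) ^ (r + 1) * ((r + 1 - 1).factorial : ℝ)) =
        -partitionSeries u fun r => (-1) ^ r * (r.factorial : ℝ) := by
      have hneg : ∀ n G, partitionNumber u n (fun r => -G r) = -partitionNumber u n G := by
        intro n
        induction n using Nat.strong_induction_on with
        | _ n ih =>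
        intro G
        cases n with
        | zero => simp [partitionNumber_zero]
        | succ n =>
          rw [partitionNumber_succ, partitionNumber_succ, ← Finset.sum_neg_distrib]
          refine Finset.sum_congr rfl fun j _ => ?_
          rw [ih (n - j) (by omega) fun r => G (r + 1)]
          ring
      ext n
      rw [map_neg, partitionSeries, partitionSeries, PowerSeries.coeff_mk, PowerSeries.coeff_mk,
        ← neg_div, ← hneg]
      congr 2
      funext r
      rw [Nat.add_sub_cancel, pow_succ]
      ring
    rw [derivative_partitionSeries, ← hB, h2, h1]
    linear_combination (-PowerSeries.derivative ℝ B) * hinv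
  · intro k
    rw [derivative_partitionSeries]
    congr 1
    congr 1
    funext r
    rw [show r + 1 + k = r + (k + 1) by ring]
  · intro k
    rw [Derivation.leibniz, PowerSeries.derivative_C, smul_zero, add_zero, smul_eq_mul,
      PowerSeries.derivative_pow, PowerSeries.derivative_inv', Nat.factorial_succ]
    simp only [Nat.add_sub_cancel, Nat.cast_add, Nat.cast_mul, Nat.cast_one, pow_succ, map_mul,
      map_neg, map_one, map_add, map_natCast]
    ring
  · intro k
    rw [partitionSeries, PowerSeries.coeff_mk, partitionNumber_zero,
      PowerSeries.coeff_zero_eq_constantCoeff_apply]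
    simp [hB0]

end PartitionSeries

/-! ### The polynomial with prescribed finite free cumulants -/

section CumulantPolynomial

/-- The normalized coefficients `b_k` of a polynomial `∑_k b_k (d)_k x^{d - k}` of degree `d`. -/
noncomputable def normalizedCoeff (d : ℕ) (p : ℝ[X]) (k : ℕ) : ℝ :=
  p.coeff (d - k) / d.descFactorial k

/-- The logarithmic partition series of the normalized coefficients. -/
noncomputable def logSeries (d : ℕ) (p : ℝ[X]) : PowerSeries ℝ :=
  partitionSeries (fun k => k.factorial * normalizedCoeff d p k)
    fun r => (-1) ^ r * (r - 1).factorial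

/-- The signs in `signedCoeff` multiply over the blocks to `(-1)^(n+1)` and cancel the sign of
`(-d)^(n+1)`. The remaining sum is the logarithmic partition series, and the factorial matches the
coefficient of its derivative. -/
theorem finiteFreeCumulant_succ (d : ℕ) (hd : d ≠ 0) (p : ℝ[X]) (n : ℕ) :
    finiteFreeCumulant d p (n + 1) =
      (d : ℝ) ^ n * PowerSeries.coeff n (PowerSeries.derivative ℝ (logSeries d p)) := by
  have hd' : (d : ℝ) ≠ 0 := Nat.cast_ne_zero.2 hd
  set u : ℕ → ℝ := fun k => k.factorial * normalizedCoeff d p k with hu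
  have hsum : ∑ π : Finpartition (Finset.univ : Finset (Fin (n + 1))),
      (-1 : ℝ) ^ π.parts.card * partitionProd (fun k => (k.factorial : ℝ)) π *
        partitionProd (signedCoeff d p) π * ((π.parts.card - 1).factorial : ℝ) /
          partitionProd (fun k => (d.descFactorial k : ℝ)) π =
      (-1) ^ (n + 1) * partitionNumber u (n + 1) fun r => (-1) ^ r * (r - 1).factorial := by
    have h1 := sum_setPartitions_eq_partitionNumber u (fun r => (-1) ^ r * (r - 1).factorial)
      (Finset.univ : Finset (Fin (n + 1)))
    have h2 := sum_finpartition_filter (s := (Finset.univ : Finset (Fin (n + 1))))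
      (fun _ => True) (fun P => ((-1) ^ P.card * ((P.card - 1).factorial : ℝ)) *
        ∏ V ∈ P, u V.card)
    rw [Finset.filter_true, Finset.filter_true] at h2
    rw [Finset.card_univ, Fintype.card_fin] at h1
    rw [← h1, ← h2, Finset.mul_sum]
    refine Finset.sum_congr rfl fun π _ => ?_
    have hsign : ∏ V ∈ π.parts, (-1 : ℝ) ^ V.card = (-1) ^ (n + 1) := by
      rw [Finset.prod_pow_eq_pow_sum, π.sum_card_parts, Finset.card_univ, Fintype.card_fin]
    have hprod : partitionProd (fun k => (k.factorial : ℝ)) π * partitionProd (signedCoeff d p) π /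
        partitionProd (fun k => (d.descFactorial k : ℝ)) π =
        (-1) ^ (n + 1) * ∏ V ∈ π.parts, u V.card := by
      rw [← hsign, ← Finset.prod_mul_distrib, partitionProd, partitionProd, partitionProd,
        ← Finset.prod_mul_distrib, ← Finset.prod_div_distrib]
      refine Finset.prod_congr rfl fun V _ => ?_
      simp only [hu, signedCoeff, normalizedCoeff]
      ring
    linear_combination ((-1 : ℝ) ^ π.parts.card * ((π.parts.card - 1).factorial : ℝ)) * hprod
  rw [finiteFreeCumulant, hsum, PowerSeries.coeff_derivative, logSeries, partitionSeries,
    PowerSeries.coeff_mk, ← hu, Nat.add_sub_cancel, Nat.factorial_succ]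
  have := Nat.factorial_pos n
  have h4 : (-(d : ℝ)) ^ (n + 1) * (-1) ^ (n + 1) = (d : ℝ) ^ (n + 1) := by
    rw [← mul_pow]; ring
  push_cast
  field_simp
  rw [h4]
  ring

/-- The coefficients of the solution of `B' = -(∑ κ_{k+1} d^{-k} s^k) B`, `B(0) = 1`. -/
noncomputable def cumulantCoeff (d : ℕ) (κ : ℕ → ℝ) : ℕ → ℝ
  | 0 => 1
  | n + 1 => -(∑ k : Fin (n + 1), κ (k + 1) / (d : ℝ) ^ (k : ℕ) * cumulantCoeff d κ (n - k)) /
      (n + 1)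
termination_by n => n

theorem cumulantCoeff_zero (d : ℕ) (κ : ℕ → ℝ) : cumulantCoeff d κ 0 = 1 := by
  rw [cumulantCoeff]

theorem cumulantCoeff_succ (d : ℕ) (κ : ℕ → ℝ) (n : ℕ) :
    cumulantCoeff d κ (n + 1) = -(∑ k ∈ Finset.range (n + 1),
      κ (k + 1) / (d : ℝ) ^ k * cumulantCoeff d κ (n - k)) / (n + 1) := by
  rw [cumulantCoeff, Finset.sum_range]

/-- `∑ κ_{k+1} d^{-k} s^k`. -/
noncomputable def cumulantSeries (d : ℕ) (κ : ℕ → ℝ) : PowerSeries ℝ :=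
  PowerSeries.mk fun k => κ (k + 1) / (d : ℝ) ^ k

theorem derivative_mk_cumulantCoeff (d : ℕ) (κ : ℕ → ℝ) :
    PowerSeries.derivative ℝ (PowerSeries.mk (cumulantCoeff d κ)) =
      -(cumulantSeries d κ * PowerSeries.mk (cumulantCoeff d κ)) := by
  ext n
  rw [map_neg, PowerSeries.coeff_derivative, PowerSeries.coeff_mk, cumulantCoeff_succ,
    PowerSeries.coeff_mul,
    Finset.Nat.sum_antidiagonal_eq_sum_range_succ
      (fun i j => PowerSeries.coeff i (cumulantSeries d κ) *
        PowerSeries.coeff j (PowerSeries.mk (cumulantCoeff d κ)))]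
  simp only [cumulantSeries, PowerSeries.coeff_mk]
  have : (n + 1 : ℝ) ≠ 0 := by positivity
  field_simp

/-- A linear differential equation of order one, solved modulo `s ^ (N + 1)`. -/
theorem cumulantCoeff_unique {d N : ℕ} {κ b : ℕ → ℝ} {K : PowerSeries ℝ} (h0 : b 0 = 1)
    (hK : ∀ j < N, PowerSeries.coeff j K = κ (j + 1) / (d : ℝ) ^ j)
    (hb : ∀ j < N, PowerSeries.coeff j (PowerSeries.derivative ℝ (PowerSeries.mk b)) =
      -PowerSeries.coeff j (K * PowerSeries.mk b)) {n : ℕ} (hn : n ≤ N) :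
    b n = cumulantCoeff d κ n := by
  induction n using Nat.strong_induction_on with
  | _ n ih =>
  cases n with
  | zero => rw [h0, cumulantCoeff_zero]
  | succ n =>
    have h := hb n (by omega)
    rw [PowerSeries.coeff_derivative, PowerSeries.coeff_mk, PowerSeries.coeff_mul,
      Finset.Nat.sum_antidiagonal_eq_sum_range_succ
        (fun i j => PowerSeries.coeff i K * PowerSeries.coeff j (PowerSeries.mk b))] at h
    have hs : ∑ k ∈ Finset.range (n + 1), PowerSeries.coeff k K *
        PowerSeries.coeff (n - k) (PowerSeries.mk b) = ∑ k ∈ Finset.range (n + 1),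
      κ (k + 1) / (d : ℝ) ^ k * cumulantCoeff d κ (n - k) := by
      refine Finset.sum_congr rfl fun k hk => ?_
      have := Finset.mem_range.1 hk
      rw [hK k (by omega), PowerSeries.coeff_mk, ih (n - k) (by omega) (by omega)]
    rw [hs] at h
    rw [cumulantCoeff_succ, eq_div_iff (by positivity), h]

/-- The monic polynomial of degree `d` with finite free cumulants `κ_1, …, κ_d`. -/
noncomputable def cumulantPoly (d : ℕ) (κ : ℕ → ℝ) : ℝ[X] :=
  ∑ k ∈ Finset.range (d + 1),
    Polynomial.monomial (d - k) (cumulantCoeff d κ k * d.descFactorial k)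

theorem coeff_cumulantPoly {d k : ℕ} (κ : ℕ → ℝ) (hk : k ≤ d) :
    (cumulantPoly d κ).coeff (d - k) = cumulantCoeff d κ k * d.descFactorial k := by
  rw [cumulantPoly, Polynomial.finsetSum_coeff, Finset.sum_eq_single k]
  · rw [Polynomial.coeff_monomial, if_pos rfl]
  · intro j hj hjk
    rw [Polynomial.coeff_monomial, if_neg]
    have := Finset.mem_range.1 hj
    omega
  · intro h
    exact absurd (Finset.mem_range.2 (by omega)) h

theorem natDegree_cumulantPoly_le (d : ℕ) (κ : ℕ → ℝ) : (cumulantPoly d κ).natDegree ≤ d :=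
  Polynomial.natDegree_sum_le_of_forall_le _ _ fun k _ =>
    (Polynomial.natDegree_monomial_le _).trans (Nat.sub_le d k)

theorem coeff_cumulantPoly_top (d : ℕ) (κ : ℕ → ℝ) : (cumulantPoly d κ).coeff d = 1 := by
  have := coeff_cumulantPoly (d := d) κ (Nat.zero_le d)
  simpa [cumulantCoeff_zero] using this

theorem monic_cumulantPoly (d : ℕ) (κ : ℕ → ℝ) : (cumulantPoly d κ).Monic :=
  Polynomial.monic_of_natDegree_le_of_coeff_eq_one d (natDegree_cumulantPoly_le d κ)
    (coeff_cumulantPoly_top d κ)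

theorem natDegree_cumulantPoly (d : ℕ) (κ : ℕ → ℝ) : (cumulantPoly d κ).natDegree = d :=
  Polynomial.natDegree_eq_of_le_of_coeff_ne_zero (natDegree_cumulantPoly_le d κ)
    (by rw [coeff_cumulantPoly_top]; exact one_ne_zero)

theorem descFactorial_ne_zero {d k : ℕ} (hk : k ≤ d) : (d.descFactorial k : ℝ) ≠ 0 := by
  rw [Nat.cast_ne_zero, Ne, Nat.descFactorial_eq_zero_iff_lt]
  omega

theorem mul_derivative_logSeries {d : ℕ} {p : ℝ[X]} (hp : p.coeff d = 1) :
    PowerSeries.mk (normalizedCoeff d p) * PowerSeries.derivative ℝ (logSeries d p) =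
      -PowerSeries.derivative ℝ (PowerSeries.mk (normalizedCoeff d p)) := by
  have h := mul_derivative_partitionSeries
    (fun k => k.factorial * normalizedCoeff d p k) (by simp [normalizedCoeff, hp])
  have he : (fun n : ℕ => (n.factorial : ℝ) * normalizedCoeff d p n / n.factorial) =
      normalizedCoeff d p := by
    funext n
    exact mul_div_cancel_left₀ _ (Nat.cast_ne_zero.2 n.factorial_ne_zero)
  rw [he] at h
  exact h

theorem finiteFreeCumulant_cumulantPoly {d n : ℕ} (κ : ℕ → ℝ) (hn : 1 ≤ n) (hnd : n ≤ d) :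
    finiteFreeCumulant d (cumulantPoly d κ) n = κ n := by
  have hd : d ≠ 0 := by omega
  obtain ⟨n, rfl⟩ : ∃ m, n = m + 1 := ⟨n - 1, by omega⟩
  rw [finiteFreeCumulant_succ d hd]
  set B := PowerSeries.mk (normalizedCoeff d (cumulantPoly d κ)) with hB
  have hlog := mul_derivative_logSeries (coeff_cumulantPoly_top d κ)
  rw [← hB] at hlog
  have hb : ∀ k ≤ d, PowerSeries.coeff k B =
      PowerSeries.coeff k (PowerSeries.mk (cumulantCoeff d κ)) := by
    intro k hk
    rw [hB, PowerSeries.coeff_mk, PowerSeries.coeff_mk, normalizedCoeff, coeff_cumulantPoly κ hk,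
      mul_div_cancel_right₀ _ (descFactorial_ne_zero hk)]
  have hunit : IsUnit B := by
    rw [PowerSeries.isUnit_iff_constantCoeff, ← PowerSeries.coeff_zero_eq_constantCoeff_apply,
      hb 0 (Nat.zero_le d), PowerSeries.coeff_mk, cumulantCoeff_zero]
    exact isUnit_one
  -- B is cut off after degree d and agrees with the exact solution only up to there. The two
  -- logarithmic derivatives are therefore compared modulo `X^d`, where the unit B can be cancelled.
  have hdvd : PowerSeries.X ^ d ∣ B * (PowerSeries.derivative ℝ (logSeries d (cumulantPoly d κ)) -
      cumulantSeries d κ) := by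
    rw [PowerSeries.X_pow_dvd_iff]
    intro m hm
    have h1 := congrArg (PowerSeries.coeff m) (derivative_mk_cumulantCoeff d κ)
    rw [mul_sub, hlog, map_sub, map_neg, PowerSeries.coeff_derivative, hb (m + 1) hm,
      ← PowerSeries.coeff_derivative, h1, map_neg, neg_neg, PowerSeries.coeff_mul, mul_comm B,
      PowerSeries.coeff_mul, sub_eq_zero]
    refine Finset.sum_congr rfl fun x hx => ?_
    have := Finset.HasAntidiagonal.mem_antidiagonal.1 hx
    rw [hb x.2 (by omega)]
  rw [hunit.dvd_mul_left, PowerSeries.X_pow_dvd_iff] at hdvd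
  have h2 := hdvd n (by omega)
  rw [map_sub, sub_eq_zero] at h2
  have hd' : (d : ℝ) ≠ 0 := Nat.cast_ne_zero.2 hd
  rw [h2, cumulantSeries, PowerSeries.coeff_mk]
  field_simp

/-- The normalized coefficients of any admissible p solve the same first-order equation up to degree
d, which determines them. From here on real-rootedness concerns one explicit polynomial. -/
theorem isCumulantPolynomial_iff {d : ℕ} {μ : Measure ℝ} {p : ℝ[X]} :
    IsCumulantPolynomial d μ p ↔ p = cumulantPoly d (freeCumulant μ) := by
  constructor
  · rintro ⟨hm, hdeg, hκ⟩
    have htop : p.coeff d = 1 := by rw [← hdeg]; exact hm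
    have hcoeff : ∀ k ≤ d, normalizedCoeff d p k = cumulantCoeff d (freeCumulant μ) k := by
      intro k hk
      refine cumulantCoeff_unique (K := PowerSeries.derivative ℝ (logSeries d p))
        (by simp [normalizedCoeff, htop]) (fun j hj => ?_) (fun j hj => ?_) hk
      · have hd : d ≠ 0 := by omega
        have hd' : (d : ℝ) ≠ 0 := Nat.cast_ne_zero.2 hd
        rw [← hκ (j + 1) (by omega) hj, finiteFreeCumulant_succ d hd]
        field_simp
      · rw [mul_comm, mul_derivative_logSeries htop, map_neg, neg_neg]
    ext i
    rcases le_or_gt i d with hi | hi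
    · have h1 := hcoeff (d - i) (Nat.sub_le d i)
      have h2 := coeff_cumulantPoly (freeCumulant μ) (Nat.sub_le d i)
      rw [Nat.sub_sub_self hi] at h2
      rw [h2, ← h1, normalizedCoeff, Nat.sub_sub_self hi,
        div_mul_cancel₀ _ (descFactorial_ne_zero (Nat.sub_le d i))]
    · rw [Polynomial.coeff_eq_zero_of_natDegree_lt (by omega),
        Polynomial.coeff_eq_zero_of_natDegree_lt (by rw [natDegree_cumulantPoly]; omega)]
  · rintro rfl
    exact ⟨monic_cumulantPoly d _, natDegree_cumulantPoly d _,
      fun n hn hnd => finiteFreeCumulant_cumulantPoly _ hn hnd⟩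

theorem mem_realRootedLimits_iff {S : Set ℕ} {μ : Measure ℝ} :
    μ ∈ realRootedLimits S ↔
      HasAllMoments μ ∧ ∀ d ∈ S, (cumulantPoly d (freeCumulant μ)).Splits := by
  simp only [realRootedLimits, Set.mem_ofPred_eq, isCumulantPolynomial_iff, exists_eq_left]

/-- The exponential turns sums of cumulants into products. -/
theorem mk_cumulantCoeff_mul (d : ℕ) (κ κ' : ℕ → ℝ) :
    PowerSeries.mk (cumulantCoeff d κ) * PowerSeries.mk (cumulantCoeff d κ') =
      PowerSeries.mk (cumulantCoeff d (κ + κ')) := by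
  set B := PowerSeries.mk (cumulantCoeff d κ) with hB
  set B' := PowerSeries.mk (cumulantCoeff d κ') with hB'
  have hmk : PowerSeries.mk (fun n => PowerSeries.coeff n (B * B')) = B * B' := by
    ext n; rw [PowerSeries.coeff_mk]
  have hK : cumulantSeries d (κ + κ') = cumulantSeries d κ + cumulantSeries d κ' := by
    ext n
    simp only [cumulantSeries, PowerSeries.coeff_mk, map_add, Pi.add_apply, add_div]
  ext n
  rw [PowerSeries.coeff_mk]
  refine cumulantCoeff_unique (N := n) (b := fun n => PowerSeries.coeff n (B * B'))
    (K := cumulantSeries d (κ + κ')) ?_ ?_ ?_ le_rfl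
  · simp [hB, hB', PowerSeries.coeff_mul, cumulantCoeff_zero]
  · intro j _
    rw [cumulantSeries, PowerSeries.coeff_mk]
  · intro j _
    rw [hmk, ← map_neg, Derivation.leibniz, derivative_mk_cumulantCoeff,
      derivative_mk_cumulantCoeff, hK, ← hB, ← hB']
    congr 1
    simp only [smul_eq_mul]
    ring

theorem cumulantPoly_congr {d : ℕ} {κ κ' : ℕ → ℝ} (h : ∀ n, 1 ≤ n → κ n = κ' n) :
    cumulantPoly d κ = cumulantPoly d κ' := by
  have : ∀ n, cumulantCoeff d κ n = cumulantCoeff d κ' n := by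
    intro n
    induction n using Nat.strong_induction_on with
    | _ n ih =>
    cases n with
    | zero => rw [cumulantCoeff_zero, cumulantCoeff_zero]
    | succ n =>
      rw [cumulantCoeff_succ, cumulantCoeff_succ]
      congr 2
      refine Finset.sum_congr rfl fun k _ => ?_
      rw [h (k + 1) (by omega), ih (n - k) (by omega)]
  simp only [cumulantPoly, this]

end CumulantPolynomial

/-! ### Laguerre's and Grace's theorems for half-planes -/

section Apolarity

/-- The apolar pairing of polynomials of degree at most `n`. -/
noncomputable def apolarPairing (n : ℕ) (f g : ℂ[X]) : ℂ :=
  ∑ k ∈ Finset.range (n + 1),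
    (-1) ^ k * (k.factorial : ℂ) * ((n - k).factorial : ℂ) * f.coeff k * g.coeff (n - k)

/-- The polar derivative of a polynomial of degree `n` with respect to the point `w`. -/
noncomputable def polarDerivative (n : ℕ) (w : ℂ) (f : ℂ[X]) : ℂ[X] :=
  C (n : ℂ) * f - (X - C w) * derivative f

theorem coeff_polarDerivative (n : ℕ) (w : ℂ) (f : ℂ[X]) (k : ℕ) :
    (polarDerivative n w f).coeff k =
      ((n : ℂ) - k) * f.coeff k + w * ((k + 1) * f.coeff (k + 1)) := by
  rw [polarDerivative, coeff_sub, coeff_C_mul, sub_mul, coeff_sub, coeff_C_mul, coeff_derivative]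
  cases k with
  | zero => simp
  | succ k =>
    rw [coeff_X_mul, coeff_derivative]
    push_cast
    ring

/-- A linear factor of g passes to f as a polar derivative and lowers the degree by one; this is the
induction step of Grace's theorem. -/
theorem apolarPairing_X_sub_C_mul (n : ℕ) (w : ℂ) (f g : ℂ[X]) (hg : g.natDegree ≤ n) :
    apolarPairing (n + 1) f ((X - C w) * g) = apolarPairing n (polarDerivative (n + 1) w f) g := by
  have hc : ∀ j, ((X - C w) * g).coeff (j + 1) = g.coeff j - w * g.coeff (j + 1) := by
    intro j
    rw [sub_mul, coeff_sub, coeff_X_mul, coeff_C_mul]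
  have hc0 : ((X - C w) * g).coeff 0 = - w * g.coeff 0 := by
    rw [sub_mul, coeff_sub, coeff_C_mul]; simp
  have h1 : apolarPairing (n + 1) f ((X - C w) * g) =
      (∑ k ∈ Finset.range (n + 1), (-1) ^ k * (k.factorial : ℂ) * ((n + 1 - k).factorial : ℂ) *
        f.coeff k * g.coeff (n - k)) -
      ∑ k ∈ Finset.range (n + 2), (-1) ^ k * (k.factorial : ℂ) * ((n + 1 - k).factorial : ℂ) *
        f.coeff k * (w * g.coeff (n + 1 - k)) := by
    rw [Finset.sum_range_succ _ (n + 1), ← sub_sub, ← Finset.sum_sub_distrib, apolarPairing,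
      Finset.sum_range_succ _ (n + 1), sub_eq_add_neg _ ((-1 : ℂ) ^ (n + 1) * _ * _ * _ * _)]
    congr 1
    · refine Finset.sum_congr rfl fun k hk => ?_
      have hk' := Finset.mem_range.1 hk
      rw [show n + 1 - k = (n - k) + 1 by omega, hc]
      ring
    · rw [Nat.sub_self, hc0]
      ring
  have hgn : g.coeff (n + 1) = 0 := coeff_eq_zero_of_natDegree_lt (by omega)
  rw [h1, Finset.sum_range_succ' _ (n + 1), Nat.sub_zero, hgn, mul_zero, mul_zero, add_zero,
    ← Finset.sum_sub_distrib, apolarPairing]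
  refine Finset.sum_congr rfl fun k hk => ?_
  have hk' := Finset.mem_range.1 hk
  rw [coeff_polarDerivative, show n + 1 - (k + 1) = n - k by omega,
    show n + 1 - k = (n - k) + 1 by omega, Nat.factorial_succ, Nat.factorial_succ]
  have : (((n - k : ℕ) : ℂ)) = n - k := by rw [Nat.cast_sub (by omega)]
  push_cast
  rw [this]
  ring

theorem sum_pos_of_forall_pos (φ : ℂ →+ ℝ) (c : ℝ) (s : Multiset ℂ) (hs : s ≠ 0)
    (h : ∀ w ∈ s, 0 < φ w + c) : 0 < φ s.sum + s.card * c := by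
  have key : ∀ t : Multiset ℂ, (∀ w ∈ t, 0 < φ w + c) → 0 ≤ φ t.sum + t.card * c := by
    intro t
    induction t using Multiset.induction_on with
    | empty => simp
    | cons a t ih =>
      intro h
      have h1 := h a (Multiset.mem_cons_self a t)
      have h2 := ih fun w hw => h w (Multiset.mem_cons_of_mem hw)
      rw [Multiset.sum_cons, Multiset.card_cons, map_add]
      push_cast
      linarith
  obtain ⟨a, ha⟩ := Multiset.exists_mem_of_ne_zero hs
  obtain ⟨t, rfl⟩ := Multiset.exists_cons_of_mem ha
  have h1 := h a ha
  have h2 := key t fun w hw => h w (Multiset.mem_cons_of_mem hw)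
  rw [Multiset.sum_cons, Multiset.card_cons, map_add]
  push_cast
  linarith

/-- The centre of mass, seen from a point of the closed lower half-plane, of points of the open
upper half-plane lies in the open upper half-plane. -/
theorem sum_inv_sub_ne {s : Multiset ℂ} (hs : s ≠ 0) (h : ∀ a ∈ s, 0 < a.im) {x w : ℂ}
    (hx : x.im ≤ 0) (hw : w.im ≤ 0) (hxw : x ≠ w) :
    (s.map fun a => 1 / (x - a)).sum ≠ s.card / (x - w) := by
  intro heq
  set v : ℂ := 1 / (x - w) with hv
  have hxw' : x - w ≠ 0 := sub_ne_zero.2 hxw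
  have hvim : v.im ≤ -x.im * Complex.normSq v := by
    have hpos : 0 < Complex.normSq (x - w) := Complex.normSq_pos.2 hxw'
    rw [hv, one_div, Complex.inv_im, Complex.normSq_inv, Complex.sub_im, ← div_eq_mul_inv,
      div_le_div_iff_of_pos_right hpos]
    linarith
  -- The map `a ↦ 1/(x - a)` sends the open upper half-plane into the convex region `Im z > c |z|²`
  -- with c = -Im x ≥ 0, and v lies outside it. Replacing `|z|²` by its tangent `2⟨z, v⟩ - |v|²` at
  -- v gives an affine function that is positive on the region and at most 0 at v.
  let φ : ℂ →+ ℝ := AddMonoidHom.mk' (fun z => z.im + 2 * x.im * (z.re * v.re + z.im * v.im))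
    (by intro a b; simp only [Complex.add_im, Complex.add_re]; ring)
  have hφ : ∀ z, φ z = z.im + 2 * x.im * (z.re * v.re + z.im * v.im) := fun _ => rfl
  have h1 := sum_pos_of_forall_pos φ (-x.im * Complex.normSq v) (s.map fun a => 1 / (x - a))
    (by simpa using hs) ?_
  · have hcard : (0 : ℝ) < s.card := by exact_mod_cast Multiset.card_pos.2 hs
    rw [heq, Multiset.card_map, hφ] at h1
    have e : (s.card : ℂ) / (x - w) = (s.card : ℝ) * v := by
      rw [hv]; push_cast; ring
    rw [e, Complex.re_ofReal_mul, Complex.im_ofReal_mul] at h1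
    have h2 : 0 < (s.card : ℝ) * (v.im + x.im * Complex.normSq v) := by
      rw [Complex.normSq_apply] at h1 ⊢
      linarith
    have h3 := (mul_pos_iff_of_pos_left hcard).1 h2
    linarith
  · intro z hz
    obtain ⟨a, ha, rfl⟩ := Multiset.mem_map.1 hz
    have hne : x - a ≠ 0 := by
      intro h0
      have := congrArg Complex.im h0
      simp only [Complex.sub_im, Complex.zero_im] at this
      linarith [h a ha]
    set z := 1 / (x - a) with hz
    have hzim : -x.im * Complex.normSq z < z.im := by
      have hpos : 0 < Complex.normSq (x - a) := Complex.normSq_pos.2 hne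
      rw [hz, one_div, Complex.inv_im, Complex.normSq_inv, Complex.sub_im, ← div_eq_mul_inv,
        div_lt_div_iff_of_pos_right hpos]
      linarith [h a ha]
    rw [hφ]
    have hsq : 0 ≤ -x.im * ((z.re - v.re) ^ 2 + (z.im - v.im) ^ 2) :=
      mul_nonneg (by linarith) (by positivity)
    rw [Complex.normSq_apply] at hzim ⊢
    linarith

/-- Laguerre's theorem: a zero x of the polar derivative in the closed lower half-plane would make w
the centre of mass of the roots of f as seen from x. The degree drops by exactly one since w is not
their ordinary centroid either. -/
theorem polarDerivative_roots {n : ℕ} {f : ℂ[X]} (hf : f.natDegree = n + 1)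
    (hroots : ∀ z, f.eval z = 0 → 0 < z.im) {w : ℂ} (hw : w.im ≤ 0) :
    (polarDerivative (n + 1) w f).natDegree = n ∧
      ∀ z, (polarDerivative (n + 1) w f).eval z = 0 → 0 < z.im := by
  have hf0 : f ≠ 0 := by rintro rfl; simp at hf
  have hsplit := IsAlgClosed.splits f
  have hcard : f.roots.card = n + 1 := by rw [← hsplit.natDegree_eq_card_roots, hf]
  have hs : f.roots ≠ 0 := by
    rw [← Multiset.card_pos, hcard]; omega
  have hr : ∀ a ∈ f.roots, 0 < a.im := fun a ha => hroots a ((mem_roots hf0).1 ha)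
  constructor
  · refine natDegree_eq_of_le_of_coeff_ne_zero (natDegree_le_iff_coeff_eq_zero.2 fun k hk => ?_) ?_
    · rw [coeff_polarDerivative, coeff_eq_zero_of_natDegree_lt (show f.natDegree < k + 1 by omega),
        mul_zero, mul_zero, add_zero]
      rcases Nat.lt_or_ge (n + 1) k with h | h
      · rw [coeff_eq_zero_of_natDegree_lt (by omega), mul_zero]
      · obtain rfl : k = n + 1 := by omega
        simp
    -- By Vieta, the coefficient in degree n is the leading coefficient of f times `(n+1) w` minus
    -- the sum of the roots.
    · have hnext : f.coeff n = -f.leadingCoeff * f.roots.sum := by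
        rw [← hsplit.nextCoeff_eq_neg_sum_roots_mul_leadingCoeff,
          nextCoeff_of_natDegree_pos (by omega), hf]
        rfl
      have hlead : f.coeff (n + 1) = f.leadingCoeff := by rw [leadingCoeff, hf]
      rw [coeff_polarDerivative, hnext, hlead]
      have hpos := sum_pos_of_forall_pos Complex.imAddGroupHom 0 f.roots hs
        (by simpa using hr)
      intro h0
      have h1 : f.leadingCoeff * ((n + 1) * w - f.roots.sum) = 0 := by
        rw [← h0]; push_cast; ring
      have h2 := (mul_eq_zero.1 h1).resolve_left (leadingCoeff_ne_zero.2 hf0)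
      have h3 : f.roots.sum = ((n + 1 : ℝ) : ℂ) * w := by
        push_cast; linear_combination -h2
      rw [h3, mul_zero, add_zero] at hpos
      simp only [Complex.coe_imAddGroupHom, Complex.im_ofReal_mul] at hpos
      have : (n + 1 : ℝ) * w.im ≤ 0 := mul_nonpos_of_nonneg_of_nonpos (by positivity) hw
      linarith
  · intro x hx
    by_contra hcon
    push Not at hcon
    have hfx : f.eval x ≠ 0 := fun h0 => absurd (hroots x h0) (not_lt.2 hcon)
    rw [polarDerivative, eval_sub, eval_mul, eval_mul, eval_sub, eval_C, eval_C, eval_X,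
      hsplit.eval_derivative_eq_eval_mul_sum hfx] at hx
    have h1 : ((n + 1 : ℕ) : ℂ) - (x - w) * (f.roots.map fun z => 1 / (x - z)).sum = 0 := by
      refine (mul_eq_zero.1 (?_ : f.eval x * _ = 0)).resolve_left hfx
      rw [← hx]; ring
    have hxw : x ≠ w := by
      rintro rfl
      rw [sub_self, zero_mul, sub_zero] at h1
      exact Nat.cast_ne_zero.2 (Nat.succ_ne_zero n) h1
    refine sum_inv_sub_ne hs hr hcon hw hxw ?_
    rw [hcard, eq_div_iff (sub_ne_zero.2 hxw)]
    linear_combination -h1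

/-- **Grace's theorem** for half-planes. -/
theorem apolarPairing_ne_zero {n : ℕ} {f g : ℂ[X]} (hf : f.natDegree = n) (hf0 : f ≠ 0)
    (hg : g.natDegree = n) (hg0 : g ≠ 0) (hfr : ∀ z, f.eval z = 0 → 0 < z.im)
    (hgr : ∀ z, g.eval z = 0 → z.im ≤ 0) : apolarPairing n f g ≠ 0 := by
  induction n generalizing f g with
  | zero =>
    have h1 : f.coeff 0 ≠ 0 := by rw [← hf]; exact leadingCoeff_ne_zero.2 hf0
    have h2 : g.coeff 0 ≠ 0 := by rw [← hg]; exact leadingCoeff_ne_zero.2 hg0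
    simp [apolarPairing, h1, h2]
  | succ n ih =>
    obtain ⟨w, hw⟩ := IsAlgClosed.exists_root g (by
      rw [degree_eq_natDegree hg0, hg]; exact_mod_cast Nat.succ_ne_zero n)
    obtain ⟨g', rfl⟩ := dvd_iff_isRoot.2 hw
    have hg0' : g' ≠ 0 := right_ne_zero_of_mul hg0
    have hg' : g'.natDegree = n := by
      rw [natDegree_mul (X_sub_C_ne_zero w) hg0', natDegree_X_sub_C] at hg
      omega
    obtain ⟨h1, h2⟩ := polarDerivative_roots hf hfr (hgr w hw)
    rw [apolarPairing_X_sub_C_mul n w f g' hg'.le]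
    refine ih h1 ?_ hg' hg0' h2 fun z hz => hgr z (by rw [eval_mul, hz, mul_zero])
    intro h0
    have := h2 0 (by rw [h0]; simp)
    simp at this

end Apolarity

/-! ### Finite free convolution preserves real roots -/

section RealRooted

theorem splits_iff_forall_im_eq_zero {p : ℝ[X]} (hp : p ≠ 0) :
    p.Splits ↔ ∀ z : ℂ, aeval z p = 0 → z.im = 0 := by
  constructor
  · intro h z hz
    obtain ⟨x, rfl⟩ := h.mem_range_of_isRoot (i := algebraMap ℝ ℂ) hp
      (show IsRoot _ z by rwa [IsRoot.def, eval_map_algebraMap])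
    simp
  · intro h
    refine Splits.of_splits_map (algebraMap ℝ ℂ) (IsAlgClosed.splits _) fun z hz => ?_
    have hz' := isRoot_of_mem_roots hz
    rw [IsRoot.def, eval_map_algebraMap] at hz'
    exact ⟨z.re, Complex.ext (by simp) (by simp [h z hz'])⟩

theorem splits_of_forall_not_im_pos {p : ℝ[X]} (hp : p ≠ 0)
    (h : ∀ z : ℂ, 0 < z.im → aeval z p ≠ 0) : p.Splits := by
  refine (splits_iff_forall_im_eq_zero hp).2 fun z hz => ?_
  rcases lt_trichotomy z.im 0 with h0 | h0 | h0
  · refine absurd ?_ (h (starRingEnd ℂ z) (by simpa using h0))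
    rw [aeval_conj, hz, map_zero]
  · exact h0
  · exact absurd hz (h z h0)

theorem coeff_comp_C_sub_X (q : ℂ[X]) (z : ℂ) (i : ℕ) :
    (q.comp (C z - X)).coeff i = (-1) ^ i * (hasseDeriv i q).eval z := by
  have : q.comp (C z - X) = (taylor z q).comp (C (-1) * X) := by
    rw [taylor_apply, comp_assoc]
    congr 1
    simp
    ring
  rw [this, comp_C_mul_X_coeff, taylor_coeff, mul_comm]

/-- By Taylor's formula, coefficient i of `q(z - ·)` is a signed divided derivative of q at z. The
sign cancels that of the pairing, and the factorials combine to `(d)_(i+m)`, leaving the Cauchy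
product of the normalized coefficients. -/
theorem apolarPairing_cumulantPoly (d : ℕ) (κ κ' : ℕ → ℝ) (z : ℂ) :
    apolarPairing d (((cumulantPoly d κ').map (algebraMap ℝ ℂ)).comp (C z - X))
      ((cumulantPoly d κ).map (algebraMap ℝ ℂ)) =
      d.factorial * aeval z (cumulantPoly d (κ + κ')) := by
  set b : ℕ → ℂ := fun k => (cumulantCoeff d κ k : ℂ) with hb
  set b' : ℕ → ℂ := fun k => (cumulantCoeff d κ' k : ℂ) with hb'
  have hfac : ∀ {k}, k ≤ d → ((d - k).factorial : ℂ) * (d.descFactorial k : ℂ) = d.factorial :=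
    fun {k} hk => by exact_mod_cast Nat.factorial_mul_descFactorial hk
  have hconv : ∀ k, (cumulantCoeff d (κ + κ') k : ℂ) =
      ∑ j ∈ Finset.range (k + 1), b j * b' (k - j) := by
    intro k
    have := congrArg (PowerSeries.coeff k) (mk_cumulantCoeff_mul d κ κ')
    rw [PowerSeries.coeff_mul, Finset.Nat.sum_antidiagonal_eq_sum_range_succ
      (fun i j => PowerSeries.coeff i (PowerSeries.mk (cumulantCoeff d κ)) *
        PowerSeries.coeff j (PowerSeries.mk (cumulantCoeff d κ')))] at this
    simp only [PowerSeries.coeff_mk] at this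
    rw [← this]
    push_cast
    rfl
  have hL : ∀ i ∈ Finset.range (d + 1), (-1) ^ i * (i.factorial : ℂ) * ((d - i).factorial : ℂ) *
      (((cumulantPoly d κ').map (algebraMap ℝ ℂ)).comp (C z - X)).coeff i *
      ((cumulantPoly d κ).map (algebraMap ℝ ℂ)).coeff (d - i) =
      d.factorial * ∑ m ∈ Finset.range (d + 1), b i * b' m * d.descFactorial (i + m) *
        z ^ (d - (i + m)) := by
    intro i hi
    have hi' : i ≤ d := by have := Finset.mem_range.1 hi; omega
    rw [coeff_comp_C_sub_X, coeff_map, coeff_cumulantPoly κ hi', cumulantPoly, Polynomial.map_sum,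
      map_sum, eval_finsetSum, ← hfac hi']
    simp only [map_monomial, hasseDeriv_monomial, eval_monomial, map_mul, Complex.coe_algebraMap,
      map_natCast]
    rw [Finset.mul_sum, Finset.mul_sum, Finset.mul_sum, Finset.sum_mul]
    refine Finset.sum_congr rfl fun m hm => ?_
    have hm' : m ≤ d := by have := Finset.mem_range.1 hm; omega
    have h1 : ((-1 : ℂ)) ^ i * (-1) ^ i = 1 := by rw [← mul_pow]; simp
    have h2 : (i.factorial : ℂ) * ((d - m).choose i : ℂ) * (d.descFactorial m : ℂ) =
        d.descFactorial (i + m) := by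
      have := Nat.descFactorial_mul_descFactorial (n := d) (Nat.le_add_left m i)
      rw [Nat.add_sub_cancel] at this
      rw [← this, Nat.descFactorial_eq_factorial_mul_choose (d - m) i]
      push_cast
      ring
    rw [← h2, show d - m - i = d - (i + m) by omega]
    linear_combination ((i.factorial : ℂ) * (d - i).factorial * ((d - m).choose i : ℂ) *
      (b' m * d.descFactorial m) * z ^ (d - (i + m)) * b i * d.descFactorial i) * h1
  rw [apolarPairing, Finset.sum_congr rfl hL, ← Finset.mul_sum]
  congr 1
  let F : ℕ → ℕ → ℂ := fun i m => b i * b' m * d.descFactorial (i + m) * z ^ (d - (i + m))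
  have hR : aeval z (cumulantPoly d (κ + κ')) = ∑ k ∈ Finset.range (d + 1),
      ∑ j ∈ Finset.range (k + 1), F j (k - j) := by
    rw [cumulantPoly, map_sum]
    refine Finset.sum_congr rfl fun k _ => ?_
    rw [aeval_monomial]
    simp only [map_mul, Complex.coe_algebraMap, map_natCast]
    rw [hconv, Finset.sum_mul, Finset.sum_mul]
    refine Finset.sum_congr rfl fun j hj => ?_
    have hj' := Finset.mem_range.1 hj
    simp only [F]
    rw [show j + (k - j) = k by omega]
  -- The pairing runs over a square of indices and the polynomial over a triangle; the extra terms
  -- have i + m > d and vanish with `(d)_(i+m)`.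
  rw [hR, Finset.sum_range_diag_flip]
  refine Finset.sum_congr rfl fun i _ => ?_
  symm
  refine Finset.sum_subset (Finset.range_subset_range.2 (by omega)) fun m _ hm => ?_
  have hm' : d < i + m := by
    have := mt Finset.mem_range.2 hm
    omega
  simp [F, Nat.descFactorial_eq_zero_iff_lt.2 hm']

/-- The finite free additive convolution of real-rooted polynomials is real-rooted. -/
theorem splits_cumulantPoly_add {d : ℕ} {κ κ' : ℕ → ℝ} (h : (cumulantPoly d κ).Splits)
    (h' : (cumulantPoly d κ').Splits) : (cumulantPoly d (κ + κ')).Splits := by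
  refine splits_of_forall_not_im_pos (monic_cumulantPoly _ _).ne_zero fun z hz h0 => ?_
  have hp := (splits_iff_forall_im_eq_zero (monic_cumulantPoly d κ).ne_zero).1 h
  have hq := (splits_iff_forall_im_eq_zero (monic_cumulantPoly d κ').ne_zero).1 h'
  have hdeg : ∀ κ, ((cumulantPoly d κ).map (algebraMap ℝ ℂ)).natDegree = d := fun κ => by
    rw [natDegree_map, natDegree_cumulantPoly]
  have hne : ∀ κ, (cumulantPoly d κ).map (algebraMap ℝ ℂ) ≠ 0 := fun κ =>
    ((monic_cumulantPoly d κ).map _).ne_zero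
  have hlin : (C z - X : ℂ[X]).natDegree = 1 := by
    rw [← neg_sub, natDegree_neg, natDegree_X_sub_C]
  refine apolarPairing_ne_zero (n := d)
    (f := ((cumulantPoly d κ').map (algebraMap ℝ ℂ)).comp (C z - X))
    (g := (cumulantPoly d κ).map (algebraMap ℝ ℂ)) ?_ ?_ (hdeg κ) (hne κ) ?_ ?_ ?_
  · rw [natDegree_comp, hdeg, hlin, mul_one]
  · intro h0
    rw [comp_eq_zero_iff] at h0
    rcases h0 with h0 | ⟨-, h0⟩
    · exact hne κ' h0
    · rw [h0, natDegree_C] at hlin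
      omega
  · intro y hy
    rw [eval_comp, eval_map_algebraMap] at hy
    have := hq _ hy
    simp only [eval_sub, eval_C, eval_X, Complex.sub_im] at this
    linarith
  · intro y hy
    rw [eval_map_algebraMap] at hy
    exact (hp y hy).le
  · rw [apolarPairing_cumulantPoly, h0, mul_zero]

/-- Each factor satisfies `|z - a| ≥ |Im z|` for real a. The bound does not depend on the roots, so
it survives limits of polynomials. -/
theorem abs_im_pow_le_norm_aeval {p : ℝ[X]} (hp : p.Monic) (hs : p.Splits) (z : ℂ) :
    |z.im| ^ p.natDegree ≤ ‖aeval z p‖ := by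
  rw [hs.natDegree_eq_card_roots]
  conv_rhs => rw [hs.eq_prod_roots_of_monic hp]
  generalize p.roots = s
  induction s using Multiset.induction_on with
  | empty => simp
  | cons a s ih =>
    rw [Multiset.map_cons, Multiset.prod_cons, map_mul, norm_mul, Multiset.card_cons, pow_succ']
    refine mul_le_mul ?_ ih (by positivity) (norm_nonneg _)
    have := Complex.abs_im_le_norm (z - a)
    simpa using this

end RealRooted

/-! ### Moments of root distributions as the degree grows -/

section RootMoments

theorem coeff_X_mul_derivative (f : PowerSeries ℝ) (n : ℕ) :
    PowerSeries.coeff n (PowerSeries.X * PowerSeries.derivative ℝ f) =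
      n * PowerSeries.coeff n f := by
  cases n with
  | zero => simp
  | succ n =>
    rw [PowerSeries.coeff_succ_X_mul, PowerSeries.coeff_derivative]
    push_cast
    ring

theorem cast_descFactorial_succ (d k : ℕ) :
    (d.descFactorial (k + 1) : ℝ) = (d - k) * d.descFactorial k := by
  rcases le_or_gt k d with h | h
  · rw [Nat.descFactorial_succ]
    push_cast [h]
    ring
  · rw [Nat.descFactorial_eq_zero_iff_lt.2 h, Nat.descFactorial_eq_zero_iff_lt.2 (by omega)]
    simp

/-- The series `(D / d) ^ n p / p` at infinity, in terms of `M = x p' / (d p)`. -/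
noncomputable def iteratedLogDerivative (d : ℕ) (M : PowerSeries ℝ) : ℕ → PowerSeries ℝ
  | 0 => 1
  | n + 1 => M * iteratedLogDerivative d M n - PowerSeries.C ((d : ℝ)⁻¹) *
      ((n : PowerSeries ℝ) * iteratedLogDerivative d M n +
        PowerSeries.X * PowerSeries.derivative ℝ (iteratedLogDerivative d M n))

/-- The coefficients at infinity of the `n`-th derivative of `cumulantPoly d κ`. -/
noncomputable def reverseDerivative (d : ℕ) (κ : ℕ → ℝ) (n : ℕ) : PowerSeries ℝ :=
  PowerSeries.mk fun k => cumulantCoeff d κ k * d.descFactorial (k + n)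

/-- With s = 1/x the n-th derivative is `x^(d-n)` times this series, and x d/dx acts on it as `d - n
- s d/ds`. -/
theorem reverseDerivative_succ (d : ℕ) (κ : ℕ → ℝ) (n : ℕ) :
    reverseDerivative d κ (n + 1) = ((d : PowerSeries ℝ) - (n : PowerSeries ℝ)) * reverseDerivative d κ n -
      PowerSeries.X * PowerSeries.derivative ℝ (reverseDerivative d κ n) := by
  ext k
  have : ((d : PowerSeries ℝ) - (n : PowerSeries ℝ)) = PowerSeries.C ((d : ℝ) - n) := by simp
  rw [map_sub, coeff_X_mul_derivative, this, PowerSeries.coeff_C_mul]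
  simp only [reverseDerivative, PowerSeries.coeff_mk]
  rw [← add_assoc, cast_descFactorial_succ]
  push_cast
  ring

theorem reverseDerivative_eq {d : ℕ} (hd : d ≠ 0) (κ : ℕ → ℝ) {M : PowerSeries ℝ}
    (hM : reverseDerivative d κ 0 * ((d : PowerSeries ℝ) * M) = (d : PowerSeries ℝ) * reverseDerivative d κ 0 -
      PowerSeries.X * PowerSeries.derivative ℝ (reverseDerivative d κ 0)) (n : ℕ) :
    reverseDerivative d κ n =
      (d : PowerSeries ℝ) ^ n * (reverseDerivative d κ 0 * iteratedLogDerivative d M n) := by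
  have hinv : (d : PowerSeries ℝ) * PowerSeries.C ((d : ℝ)⁻¹) = 1 := by
    rw [← map_natCast (PowerSeries.C (R := ℝ)), ← map_mul,
      mul_inv_cancel₀ (Nat.cast_ne_zero.2 hd), map_one]
  induction n with
  | zero => simp [iteratedLogDerivative]
  | succ n ih =>
    have hd' : PowerSeries.derivative ℝ ((d : PowerSeries ℝ) ^ n) = 0 := by
      rw [← Nat.cast_pow, ← map_natCast (PowerSeries.C (R := ℝ)), PowerSeries.derivative_C]
    rw [reverseDerivative_succ, ih, Derivation.leibniz, Derivation.leibniz, hd',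
      iteratedLogDerivative]
    simp only [smul_eq_mul, mul_zero, add_zero]
    set W := iteratedLogDerivative d M n
    set R := reverseDerivative d κ 0
    linear_combination (-(d : PowerSeries ℝ) ^ n * W) * hM + (d : PowerSeries ℝ) ^ n * R *
      ((n : PowerSeries ℝ) * W + PowerSeries.X * PowerSeries.derivative ℝ W) * hinv

/-- The differential equation `x p' = d (p + ∑ κ_n d^{-n} p^{(n)})`, coefficientwise. -/
theorem coeff_reverseDerivative_one {d : ℕ} (hd : d ≠ 0) (κ : ℕ → ℝ) (m : ℕ) :
    PowerSeries.coeff m (reverseDerivative d κ 1) = d * (PowerSeries.coeff m (reverseDerivative d κ 0)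
      + ∑ n ∈ Finset.Icc 1 m,
        κ n / (d : ℝ) ^ n * PowerSeries.coeff (m - n) (reverseDerivative d κ n)) := by
  have hd' : (d : ℝ) ≠ 0 := Nat.cast_ne_zero.2 hd
  simp only [reverseDerivative, PowerSeries.coeff_mk, add_zero]
  have h1 : ∑ n ∈ Finset.Icc 1 m, κ n / (d : ℝ) ^ n *
      (cumulantCoeff d κ (m - n) * (d.descFactorial (m - n + n) : ℝ)) =
      (∑ n ∈ Finset.Icc 1 m, κ n / (d : ℝ) ^ n * cumulantCoeff d κ (m - n)) *
        d.descFactorial m := by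
    rw [Finset.sum_mul]
    refine Finset.sum_congr rfl fun n hn => ?_
    rw [Nat.sub_add_cancel (Finset.mem_Icc.1 hn).2]
    ring
  have h2 : (m : ℝ) * cumulantCoeff d κ m =
      -(d * ∑ n ∈ Finset.Icc 1 m, κ n / (d : ℝ) ^ n * cumulantCoeff d κ (m - n)) := by
    cases m with
    | zero => simp
    | succ m =>
      rw [cumulantCoeff_succ, ← Finset.Ico_succ_right_eq_Icc, Finset.sum_Ico_eq_sum_range,
        Finset.mul_sum]
      push_cast
      rw [mul_div_cancel₀ _ (by positivity)]
      congr 1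
      refine Finset.sum_congr rfl fun k _ => ?_
      rw [add_comm 1 k, Nat.add_sub_add_right, pow_succ]
      field_simp
  rw [h1, cast_descFactorial_succ]
  linear_combination (-(d.descFactorial m : ℝ)) * h2

/-- Dividing the differential equation by p, a unit at infinity, gives `M = 1 + ∑ κ_n X^n W_n`,
where W_n replaces the power `M^n` of the free functional equation. -/
theorem coeff_eq_sum_iteratedLogDerivative {d : ℕ} (hd : d ≠ 0) (κ : ℕ → ℝ) {M : PowerSeries ℝ}
    (hM : reverseDerivative d κ 0 * ((d : PowerSeries ℝ) * M) = (d : PowerSeries ℝ) * reverseDerivative d κ 0 -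
      PowerSeries.X * PowerSeries.derivative ℝ (reverseDerivative d κ 0)) (m : ℕ) :
    PowerSeries.coeff m M = (if m = 0 then 1 else 0) + ∑ n ∈ Finset.Icc 1 m,
      κ n * PowerSeries.coeff (m - n) (iteratedLogDerivative d M n) := by
  have hd' : (d : ℝ) ≠ 0 := Nat.cast_ne_zero.2 hd
  set R := reverseDerivative d κ 0 with hR
  set W := iteratedLogDerivative d M with hW
  have hunit : IsUnit R := by
    rw [PowerSeries.isUnit_iff_constantCoeff, ← PowerSeries.coeff_zero_eq_constantCoeff_apply]
    simp [hR, reverseDerivative, cumulantCoeff_zero]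
  have hcoeff : ∀ n j, PowerSeries.coeff j (reverseDerivative d κ n) =
      (d : ℝ) ^ n * PowerSeries.coeff j (R * W n) := by
    intro n j
    rw [reverseDerivative_eq hd κ hM n, ← Nat.cast_pow, ← map_natCast (PowerSeries.C (R := ℝ)),
      PowerSeries.coeff_C_mul, Nat.cast_pow]
  have hW1 : W 1 = M := by
    rw [hW, iteratedLogDerivative, iteratedLogDerivative]
    simp
  set E : PowerSeries ℝ := M - (1 + ∑ n ∈ Finset.Icc 1 m, PowerSeries.C (κ n) *
    (PowerSeries.X ^ n * W n)) with hE
  have hdvd : PowerSeries.X ^ (m + 1) ∣ R * E := by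
    rw [PowerSeries.X_pow_dvd_iff]
    intro i hi
    have h1 := coeff_reverseDerivative_one hd κ i
    rw [hcoeff 1, pow_one, hW1, ← hR] at h1
    have h2 := mul_left_cancel₀ hd' h1
    rw [hE, mul_sub, mul_add, mul_one, map_sub, map_add, h2, Finset.mul_sum, map_sum, sub_eq_zero]
    congr 1
    refine Finset.sum_subset_zero_on_sdiff (Finset.Icc_subset_Icc_right (by omega)) ?_ ?_
    · intro n hn
      have hn' : ¬ n ≤ i := by
        have := Finset.mem_sdiff.1 hn
        simp only [Finset.mem_Icc] at this
        omega
      rw [mul_left_comm, PowerSeries.coeff_C_mul, mul_left_comm, PowerSeries.coeff_X_pow_mul',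
        if_neg hn', mul_zero]
    · intro n hn
      rw [hcoeff n, mul_left_comm R, PowerSeries.coeff_C_mul, mul_left_comm R,
        PowerSeries.coeff_X_pow_mul', if_pos (Finset.mem_Icc.1 hn).2]
      field_simp
  rw [hunit.dvd_mul_left, PowerSeries.X_pow_dvd_iff] at hdvd
  have h3 := hdvd m (Nat.lt_succ_self m)
  rw [hE, map_sub, sub_eq_zero, map_add, PowerSeries.coeff_one, map_sum] at h3
  rw [h3]
  congr 1
  refine Finset.sum_congr rfl fun n hn => ?_
  rw [PowerSeries.coeff_C_mul, PowerSeries.coeff_X_pow_mul', if_pos (Finset.mem_Icc.1 hn).2]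

/-- As the degree tends to infinity, finite free cumulants become free cumulants. -/
theorem tendsto_coeff_ncNumber {d : ℕ → ℕ} (hd : Tendsto d atTop atTop) (κ : ℕ → ℝ)
    {M : ℕ → PowerSeries ℝ}
    (hM : ∀ j m, PowerSeries.coeff m (M j) = (if m = 0 then 1 else 0) + ∑ n ∈ Finset.Icc 1 m,
      κ n * PowerSeries.coeff (m - n) (iteratedLogDerivative (d j) (M j) n)) (m : ℕ) :
    Tendsto (fun j => PowerSeries.coeff m (M j)) atTop (𝓝 (ncNumber κ m 0)) := by
  have hdinv : Tendsto (fun j => ((d j : ℝ))⁻¹) atTop (𝓝 0) :=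
    tendsto_inv_atTop_zero.comp (tendsto_natCast_atTop_atTop.comp hd)
  induction m using Nat.strong_induction_on with
  | _ m ih =>
  set C₀ : PowerSeries ℝ := PowerSeries.mk fun i => ncNumber κ i 0 with hC₀
  have hW : ∀ n, ∀ i < m, Tendsto (fun j => PowerSeries.coeff i
      (iteratedLogDerivative (d j) (M j) n)) atTop (𝓝 (PowerSeries.coeff i (C₀ ^ n))) := by
    intro n
    induction n with
    | zero =>
      intro i _
      simp only [iteratedLogDerivative, pow_zero]
      exact tendsto_const_nhds
    | succ n ihn =>
      intro i hi
      -- The recursion for W_n differs from that for `M^n` only by a term with factor 1/d.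
      -- Coefficients of index below m involve only coefficients of M of index below m, so strong
      -- induction on m closes.
      have hform : ∀ j, PowerSeries.coeff i (iteratedLogDerivative (d j) (M j) (n + 1)) =
          (∑ x ∈ Finset.HasAntidiagonal.antidiagonal i, PowerSeries.coeff x.1 (M j) *
            PowerSeries.coeff x.2 (iteratedLogDerivative (d j) (M j) n)) -
          ((d j : ℝ))⁻¹ * ((n + i : ℝ) *
            PowerSeries.coeff i (iteratedLogDerivative (d j) (M j) n)) := by
        intro j
        rw [iteratedLogDerivative, map_sub, PowerSeries.coeff_mul, PowerSeries.coeff_C_mul,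
          map_add, coeff_X_mul_derivative, ← map_natCast (PowerSeries.C (R := ℝ)),
          PowerSeries.coeff_C_mul]
        ring
      simp only [hform]
      have hlim : PowerSeries.coeff i (C₀ ^ (n + 1)) =
          (∑ x ∈ Finset.HasAntidiagonal.antidiagonal i, ncNumber κ x.1 0 *
            PowerSeries.coeff x.2 (C₀ ^ n)) - 0 * ((n + i : ℝ) * PowerSeries.coeff i (C₀ ^ n)) := by
        rw [pow_succ', PowerSeries.coeff_mul, zero_mul, sub_zero]
        simp only [hC₀, PowerSeries.coeff_mk]
      rw [hlim]
      refine Tendsto.sub (tendsto_finsetSum _ fun x hx => ?_)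
        (hdinv.mul (tendsto_const_nhds.mul (ihn i hi)))
      have hx' := Finset.HasAntidiagonal.mem_antidiagonal.1 hx
      exact (ih x.1 (by omega)).mul (ihn x.2 (by omega))
  rw [coeff_mk_ncNumber]
  simp only [hM]
  refine tendsto_const_nhds.add (tendsto_finsetSum _ fun n hn => ?_)
  have := Finset.mem_Icc.1 hn
  exact tendsto_const_nhds.mul (hW n (m - n) (by omega))

/-- The generating function of the power sums of a multiset. -/
theorem prod_mul_sum_geometric (s : Multiset ℝ) :
    (s.map fun a => 1 - PowerSeries.C a * PowerSeries.X).prod *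
      (s.map fun a => PowerSeries.mk fun k => a ^ k).sum =
    (s.card : PowerSeries ℝ) * (s.map fun a => 1 - PowerSeries.C a * PowerSeries.X).prod - PowerSeries.X *
      PowerSeries.derivative ℝ (s.map fun a => 1 - PowerSeries.C a * PowerSeries.X).prod := by
  induction s using Multiset.induction_on with
  | empty => simp
  | cons a s ih =>
    have hgeo : (1 - PowerSeries.C a * PowerSeries.X) * (PowerSeries.mk fun k => a ^ k) = 1 := by
      ext k
      rw [sub_mul, one_mul, mul_assoc, map_sub, PowerSeries.coeff_C_mul]
      cases k with
      | zero => simp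
      | succ k =>
        rw [PowerSeries.coeff_succ_X_mul, PowerSeries.coeff_mk, PowerSeries.coeff_mk,
          PowerSeries.coeff_one, if_neg (Nat.succ_ne_zero k), pow_succ']
        ring
    have hder : PowerSeries.derivative ℝ (1 - PowerSeries.C a * PowerSeries.X) =
        -PowerSeries.C a := by
      rw [map_sub, Derivation.leibniz, PowerSeries.derivative_C, PowerSeries.derivative_X]
      simp
    rw [Multiset.map_cons, Multiset.prod_cons, Multiset.map_cons, Multiset.sum_cons,
      Multiset.card_cons, Derivation.leibniz, hder]
    simp only [smul_eq_mul, Nat.cast_add, Nat.cast_one]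
    linear_combination (s.map fun a => 1 - PowerSeries.C a * PowerSeries.X).prod * hgeo +
      (1 - PowerSeries.C a * PowerSeries.X) * ih

theorem reverse_prod_X_sub_C (s : Multiset ℝ) :
    (((s.map fun a => X - C a).prod.reverse : ℝ[X]) : PowerSeries ℝ) =
      (s.map fun a => 1 - PowerSeries.C a * PowerSeries.X).prod := by
  induction s using Multiset.induction_on with
  | empty =>
    have h : (1 : ℝ[X]).reverse = 1 := by rw [← C_1, reverse_C]
    simp [h]
  | cons a s ih =>
    have h : ((X - C a : ℝ[X])).reverse = 1 - C a * X := by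
      ext k
      rw [coeff_reverse, natDegree_X_sub_C, coeff_sub, coeff_sub]
      match k with
      | 0 => rw [revAt_le (Nat.zero_le 1)]; simp [coeff_C]
      | 1 => rw [revAt_le le_rfl]; simp [coeff_one]
      | k + 2 => rw [revAt_eq_self_of_lt (by omega)]; simp [coeff_X, coeff_one]
    rw [Multiset.map_cons, Multiset.prod_cons, Multiset.map_cons, Multiset.prod_cons,
      reverse_mul_of_domain, Polynomial.coe_mul, ih, h]
    simp

theorem reverseDerivative_zero_eq {d : ℕ} {κ : ℕ → ℝ} (hs : (cumulantPoly d κ).Splits) :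
    reverseDerivative d κ 0 =
      ((cumulantPoly d κ).roots.map fun a => 1 - PowerSeries.C a * PowerSeries.X).prod := by
  rw [← reverse_prod_X_sub_C, ← hs.eq_prod_roots_of_monic (monic_cumulantPoly d κ)]
  ext k
  rw [Polynomial.coeff_coe, coeff_reverse, natDegree_cumulantPoly, reverseDerivative,
    PowerSeries.coeff_mk, add_zero]
  rcases le_or_gt k d with h | h
  · rw [revAt_le h, coeff_cumulantPoly κ h]
  · rw [revAt_eq_self_of_lt h, Nat.descFactorial_eq_zero_iff_lt.2 h,
      coeff_eq_zero_of_natDegree_lt (by rwa [natDegree_cumulantPoly])]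
    simp

/-- The moments of the root distributions of polynomials with given finite free cumulants converge
to the moments with the corresponding free cumulants. -/
theorem tendsto_root_moments {d : ℕ → ℕ} (hd : Tendsto d atTop atTop) (hd0 : ∀ j, d j ≠ 0)
    (κ : ℕ → ℝ) (hs : ∀ j, (cumulantPoly (d j) κ).Splits) (m : ℕ) :
    Tendsto (fun j => (d j : ℝ)⁻¹ * ((cumulantPoly (d j) κ).roots.map fun a => a ^ m).sum) atTop
      (𝓝 (ncNumber κ m 0)) := by
  let G : ℕ → PowerSeries ℝ := fun j =>
    ((cumulantPoly (d j) κ).roots.map fun a => PowerSeries.mk fun k => a ^ k).sum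
  have hG : ∀ j m, PowerSeries.coeff m (PowerSeries.C ((d j : ℝ)⁻¹) * G j) =
      (d j : ℝ)⁻¹ * ((cumulantPoly (d j) κ).roots.map fun a => a ^ m).sum := by
    intro j m
    rw [PowerSeries.coeff_C_mul]
    simp only [G]
    rw [map_multiset_sum, Multiset.map_map]
    simp
  simp only [← hG]
  refine tendsto_coeff_ncNumber hd κ (M := fun j => PowerSeries.C ((d j : ℝ)⁻¹) * G j)
    (fun j => coeff_eq_sum_iteratedLogDerivative (hd0 j) κ ?_) m
  have hcard : (cumulantPoly (d j) κ).roots.card = d j := by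
    rw [← (hs j).natDegree_eq_card_roots, natDegree_cumulantPoly]
  have h := prod_mul_sum_geometric (cumulantPoly (d j) κ).roots
  rw [hcard, ← reverseDerivative_zero_eq (hs j)] at h
  rw [← h, ← mul_assoc (d j : PowerSeries ℝ), ← map_natCast (PowerSeries.C (R := ℝ)), ← map_mul,
    mul_inv_cancel₀ (Nat.cast_ne_zero.2 (hd0 j)), map_one, one_mul]

end RootMoments

/-! ### Tightness and limits of moment sequences -/

section MomentLimits

/-- Truncation of a real number to `[-R, R]`. -/
noncomputable def truncReal (R x : ℝ) : ℝ := max (-R) (min R x)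

theorem continuous_truncReal (R : ℝ) : Continuous (truncReal R) := by
  unfold truncReal; fun_prop

theorem truncReal_eq_self {R x : ℝ} (h : |x| ≤ R) : truncReal R x = x := by
  obtain ⟨h1, h2⟩ := abs_le.1 h
  rw [truncReal, min_eq_right h2, max_eq_right h1]

theorem abs_truncReal_le {R : ℝ} (hR : 0 ≤ R) (x : ℝ) : |truncReal R x| ≤ R :=
  abs_le.2 ⟨le_max_left _ _, max_le (by linarith) (min_le_left _ _)⟩

theorem abs_truncReal_le_abs {R : ℝ} (hR : 0 ≤ R) (x : ℝ) : |truncReal R x| ≤ |x| := by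
  rcases le_or_gt |x| R with h | h
  · rw [truncReal_eq_self h]
  · exact (abs_truncReal_le hR x).trans h.le

/-- The bounded continuous function `x ↦ (truncReal R x) ^ n`. -/
noncomputable def truncPow (R : ℝ) (hR : 0 ≤ R) (n : ℕ) : BoundedContinuousFunction ℝ ℝ :=
  BoundedContinuousFunction.ofNormedAddCommGroup (fun x => truncReal R x ^ n)
    ((continuous_truncReal R).pow n) (R ^ n) fun x => by
      rw [norm_pow, Real.norm_eq_abs]
      exact pow_le_pow_left₀ (abs_nonneg _) (abs_truncReal_le hR x) n

theorem abs_pow_le_one_add (x : ℝ) {m n : ℕ} (h : m ≤ 2 * n) : |x| ^ m ≤ 1 + x ^ (2 * n) := by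
  have h0 : 0 ≤ x ^ (2 * n) := by rw [pow_mul]; positivity
  rcases le_or_gt |x| 1 with h1 | h1
  · linarith [pow_le_one₀ (abs_nonneg x) h1 (n := m)]
  · have h2 := pow_le_pow_right₀ h1.le h
    rw [pow_mul |x| 2 n, sq_abs, ← pow_mul] at h2
    linarith

/-- Where truncation acts, `|x|^n ≤ |x|^(n+1) / R`. The exponent `2 (n+1)` is even, so the error is
bounded by an ordinary moment, uniformly over measures whose moments are bounded. -/
theorem abs_pow_sub_truncReal_pow_le {R : ℝ} (hR : 0 < R) (n : ℕ) (x : ℝ) :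
    |x ^ n - truncReal R x ^ n| ≤ 2 / R * (1 + x ^ (2 * (n + 1))) := by
  have h0 : 0 ≤ x ^ (2 * (n + 1)) := by rw [pow_mul]; positivity
  rcases le_or_gt |x| R with h | h
  · rw [truncReal_eq_self h, sub_self, abs_zero]
    positivity
  · have h1 : |x ^ n - truncReal R x ^ n| ≤ 2 * |x| ^ n := by
      refine (abs_sub _ _).trans ?_
      rw [abs_pow, abs_pow]
      linarith [pow_le_pow_left₀ (abs_nonneg _) (abs_truncReal_le_abs hR.le x) n]
    have h2 : |x| ^ n * R ≤ |x| ^ (n + 1) := by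
      rw [pow_succ]
      exact mul_le_mul_of_nonneg_left h.le (by positivity)
    have h3 := abs_pow_le_one_add x (show n + 1 ≤ 2 * (n + 1) by omega)
    rw [div_mul_eq_mul_div, le_div_iff₀ hR]
    nlinarith

theorem abs_realMoment_sub_le {μ : Measure ℝ} (hμ : HasAllMoments μ) {R : ℝ} (hR : 0 < R) (n : ℕ) :
    |realMoment μ n - ∫ x, truncPow R hR.le n x ∂μ| ≤
      2 / R * (1 + realMoment μ (2 * (n + 1))) := by
  have := hμ.1
  have hint := (truncPow R hR.le n).integrable μ
  rw [realMoment, ← integral_sub (hμ.2 n) hint]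
  refine (abs_integral_le_integral_abs).trans ?_
  have h1 : ∫ x, 2 / R * (1 + x ^ (2 * (n + 1))) ∂μ =
      2 / R * (1 + realMoment μ (2 * (n + 1))) := by
    rw [integral_const_mul, integral_add (integrable_const _) (hμ.2 _)]
    simp [realMoment]
  rw [← h1]
  exact integral_mono ((hμ.2 n).sub hint).abs
    (((integrable_const _).add (hμ.2 _)).const_mul _)
    fun x => abs_pow_sub_truncReal_pow_le hR n x

/-- Chebyshev's inequality: the mass outside [-T, T] is at most B / T². -/
theorem isTightMeasureSet_of_second_moment_le {S : Set (Measure ℝ)} (hS : ∀ μ ∈ S, HasAllMoments μ)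
    {B : ℝ} (hB : ∀ μ ∈ S, realMoment μ 2 ≤ B) : IsTightMeasureSet S := by
  rw [isTightMeasureSet_iff_exists_isCompact_measure_compl_le]
  intro ε hε
  obtain ⟨δ, hδ, hδε⟩ : ∃ δ : ℝ, 0 < δ ∧ ENNReal.ofReal δ ≤ ε := by
    rcases eq_or_ne ε ⊤ with rfl | h
    · exact ⟨1, one_pos, le_top⟩
    · exact ⟨ε.toReal, ENNReal.toReal_pos hε.ne' h, (ENNReal.ofReal_toReal h).le⟩
  obtain ⟨T, hT0, hT⟩ : ∃ T : ℝ, 0 < T ∧ B ≤ δ * T ^ 2 := by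
    refine ⟨|B| / δ + 1, by positivity, ?_⟩
    have h1 : |B| = δ * (|B| / δ) := by field_simp
    have h2 : 0 ≤ |B| / δ := by positivity
    calc B ≤ |B| := le_abs_self B
      _ = δ * (|B| / δ) := h1
      _ ≤ δ * (|B| / δ + 1) ^ 2 := by
        refine mul_le_mul_of_nonneg_left ?_ hδ.le
        nlinarith
  refine ⟨Set.Icc (-T) T, isCompact_Icc, fun μ hμ => ?_⟩
  have hprob := (hS μ hμ).1
  have h1 := mul_meas_ge_le_integral_of_nonneg (μ := μ) (f := fun x : ℝ => x ^ 2)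
    (ae_of_all _ fun x => sq_nonneg x) ((hS μ hμ).2 2) (T ^ 2)
  have h2 : (Set.Icc (-T) T)ᶜ ⊆ {x : ℝ | T ^ 2 ≤ x ^ 2} := by
    intro x hx
    rw [Set.mem_compl_iff, Set.mem_Icc, ← abs_le, not_le] at hx
    rw [Set.mem_ofPred_eq, sq_le_sq, abs_of_pos hT0]
    exact hx.le
  refine (measure_mono h2).trans (le_trans ?_ hδε)
  rw [← ofReal_measureReal]
  refine ENNReal.ofReal_le_ofReal ?_
  have h3 : T ^ 2 * μ.real {x : ℝ | T ^ 2 ≤ x ^ 2} ≤ T ^ 2 * δ := by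
    have := hB μ hμ
    rw [realMoment] at this
    linarith
  exact le_of_mul_le_mul_left h3 (by positivity)

/-- Limits of moment sequences are moment sequences. -/
theorem exists_hasAllMoments_of_tendsto {μ : ℕ → Measure ℝ} (hμ : ∀ j, HasAllMoments (μ j))
    {c : ℕ → ℝ} (hc : ∀ n, Tendsto (fun j => realMoment (μ j) n) atTop (𝓝 (c n))) :
    ∃ ρ, HasAllMoments ρ ∧ ∀ n, realMoment ρ n = c n := by
  let ν : ℕ → ProbabilityMeasure ℝ := fun j => ⟨μ j, (hμ j).1⟩
  obtain ⟨B, hB⟩ := (hc 2).bddAbove_range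
  have htight : IsTightMeasureSet {((m : ProbabilityMeasure ℝ) : Measure ℝ) | m ∈ Set.range ν} := by
    refine isTightMeasureSet_of_second_moment_le (B := B) ?_ ?_
    · rintro _ ⟨_, ⟨j, rfl⟩, rfl⟩
      exact hμ j
    · rintro _ ⟨_, ⟨j, rfl⟩, rfl⟩
      exact hB ⟨j, rfl⟩
  -- Prokhorov's theorem gives a weak cluster point. An ultrafilter serves as the subsequence, and
  -- the moments still converge along it.
  obtain ⟨ρ, -, hρ⟩ := (isCompact_closure_of_isTightMeasureSet htight).exists_mapClusterPt
    (f := atTop) (u := ν) (by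
      rw [le_principal_iff, mem_map]
      exact univ_mem' fun j => subset_closure ⟨j, rfl⟩)
  obtain ⟨U, hU, hlim⟩ := mapClusterPt_iff_ultrafilter.1 hρ
  have hint : ∀ f : BoundedContinuousFunction ℝ ℝ,
      Tendsto (fun j => ∫ x, f x ∂(μ j)) U (𝓝 (∫ x, f x ∂(ρ : Measure ℝ))) :=
    fun f => ProbabilityMeasure.tendsto_iff_forall_integral_tendsto.1 hlim f
  have hcU : ∀ n, Tendsto (fun j => realMoment (μ j) n) U (𝓝 (c n)) := fun n => (hc n).mono_left hU
  have hbound : ∀ (R : ℝ) (hR : 0 < R) (n : ℕ),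
      |c n - ∫ x, truncPow R hR.le n x ∂(ρ : Measure ℝ)| ≤ 2 / R * (1 + c (2 * (n + 1))) := by
    intro R hR n
    exact le_of_tendsto_of_tendsto' ((hcU n).sub (hint _)).abs
      (tendsto_const_nhds.mul (tendsto_const_nhds.add (hcU _)))
      fun j => abs_realMoment_sub_le (hμ j) hR n
  -- Weak convergence bounds the truncated even moments of ρ by c(2n), and Fatou's lemma removes the
  -- truncation.
  have heven : ∀ n, Integrable (fun x : ℝ => x ^ (2 * n)) (ρ : Measure ℝ) := by
    intro n
    have hnn : ∀ y : ℝ, 0 ≤ y ^ (2 * n) := fun y => by rw [pow_mul]; positivity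
    have hle : ∀ R : ℕ, ∫⁻ x, ENNReal.ofReal (truncReal R x ^ (2 * n)) ∂(ρ : Measure ℝ) ≤
        ENNReal.ofReal (c (2 * n)) := by
      intro R
      have h1 : ∫ x, truncPow R (Nat.cast_nonneg R) (2 * n) x ∂(ρ : Measure ℝ) ≤ c (2 * n) := by
        refine le_of_tendsto_of_tendsto' (hint _) (hcU _) fun j => ?_
        have := (hμ j).1
        refine integral_mono ((truncPow R (Nat.cast_nonneg R) (2 * n)).integrable _)
          ((hμ j).2 _) fun x => ?_
        change truncReal R x ^ (2 * n) ≤ x ^ (2 * n)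
        rw [pow_mul, pow_mul, ← sq_abs, ← sq_abs x]
        exact pow_le_pow_left₀ (by positivity)
          (pow_le_pow_left₀ (abs_nonneg _) (abs_truncReal_le_abs (Nat.cast_nonneg R) x) 2) n
      have h2 := ofReal_integral_eq_lintegral_ofReal
        ((truncPow R (Nat.cast_nonneg R) (2 * n)).integrable (ρ : Measure ℝ))
        (ae_of_all _ fun x => hnn _)
      exact h2.symm.trans_le (ENNReal.ofReal_le_ofReal h1)
    refine ⟨(continuous_pow _).aestronglyMeasurable, ?_⟩
    rw [hasFiniteIntegral_iff_ofReal (ae_of_all _ hnn)]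
    refine lt_of_le_of_lt ?_ (ENNReal.ofReal_lt_top (r := c (2 * n)))
    have hFatou := lintegral_liminf_le (μ := (ρ : Measure ℝ)) (u := atTop)
      (f := fun (R : ℕ) x => ENNReal.ofReal (truncReal R x ^ (2 * n)))
      (fun R => ENNReal.measurable_ofReal.comp
        (((continuous_truncReal R).pow _).measurable))
    have hlim' : ∀ x : ℝ, liminf (fun R : ℕ => ENNReal.ofReal (truncReal R x ^ (2 * n))) atTop =
        ENNReal.ofReal (x ^ (2 * n)) := by
      intro x
      refine Tendsto.liminf_eq (tendsto_const_nhds.congr' ?_)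
      obtain ⟨N, hN⟩ := exists_nat_ge |x|
      filter_upwards [eventually_ge_atTop N] with R hR
      rw [truncReal_eq_self (hN.trans (Nat.cast_le.2 hR))]
    simp only [hlim'] at hFatou
    refine hFatou.trans (liminf_le_of_le (by isBoundedDefault) fun b hb => ?_)
    obtain ⟨R, hR⟩ := hb.exists
    exact hR.trans (hle R)
  have hρm : HasAllMoments (ρ : Measure ℝ) := by
    refine ⟨inferInstance, fun n => ?_⟩
    refine ((integrable_const (1 : ℝ)).add (heven n)).mono' (continuous_pow _).aestronglyMeasurable
      (ae_of_all _ fun x => ?_)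
    rw [norm_pow, Real.norm_eq_abs]
    exact abs_pow_le_one_add x (by omega)
  refine ⟨ρ, hρm, fun n => ?_⟩
  set K := (1 + realMoment (ρ : Measure ℝ) (2 * (n + 1))) + (1 + c (2 * (n + 1))) with hK
  -- Both the moment of ρ and c n are within O(1/R) of the same truncated integral; R then tends to
  -- infinity.
  have hsmall : ∀ R : ℝ, 0 < R → |realMoment (ρ : Measure ℝ) n - c n| ≤ 2 / R * K := by
    intro R hR
    have h1 := abs_realMoment_sub_le hρm hR n
    have h2 := hbound R hR n
    rw [abs_sub_comm] at h2
    have h3 := abs_sub_le (realMoment (ρ : Measure ℝ) n)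
      (∫ x, truncPow R hR.le n x ∂(ρ : Measure ℝ)) (c n)
    rw [hK, mul_add]
    linarith
  have hzero : Tendsto (fun R : ℝ => 2 / R * K) atTop (𝓝 0) := by
    simpa using (tendsto_const_nhds.div_atTop tendsto_id).mul_const K
  have := ge_of_tendsto hzero (by
    filter_upwards [eventually_gt_atTop 0] with R hR using hsmall R hR)
  exact sub_eq_zero.1 (abs_eq_zero.1 (le_antisymm this (abs_nonneg _)))

/-- The uniform probability measure on a multiset. -/
noncomputable def empiricalMeasure (s : Multiset ℝ) : Measure ℝ :=
  (s.card : ENNReal)⁻¹ • (s.map Measure.dirac).sum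

theorem integral_sum_dirac (s : Multiset ℝ) (f : ℝ → ℝ) :
    Integrable f (s.map Measure.dirac).sum ∧
      ∫ x, f x ∂(s.map Measure.dirac).sum = (s.map f).sum := by
  induction s using Multiset.induction_on with
  | empty => simp
  | cons a s ih =>
    have ha : Integrable f (Measure.dirac a) := integrable_dirac (by simp)
    rw [Multiset.map_cons, Multiset.sum_cons, Multiset.map_cons, Multiset.sum_cons]
    exact ⟨ha.add_measure ih.1, by rw [integral_add_measure ha ih.1, ih.2, integral_dirac]⟩

theorem hasAllMoments_empiricalMeasure {s : Multiset ℝ} (hs : s.card ≠ 0) :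
    HasAllMoments (empiricalMeasure s) := by
  have hcard : (s.card : ENNReal) ≠ 0 := Nat.cast_ne_zero.2 hs
  refine ⟨⟨?_⟩, fun n => ?_⟩
  · have : ∀ t : Multiset ℝ, (t.map Measure.dirac).sum Set.univ = (t.card : ENNReal) := by
      intro t
      induction t using Multiset.induction_on with
      | empty => simp
      | cons a t ih => simp [ih, add_comm]
    rw [empiricalMeasure, Measure.smul_apply, this, smul_eq_mul,
      ENNReal.inv_mul_cancel hcard (ENNReal.natCast_ne_top _)]
  · exact (integral_sum_dirac s _).1.smul_measure (ENNReal.inv_ne_top.2 hcard)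

theorem realMoment_empiricalMeasure (s : Multiset ℝ) (n : ℕ) :
    realMoment (empiricalMeasure s) n = (s.card : ℝ)⁻¹ * (s.map fun a => a ^ n).sum := by
  rw [realMoment, empiricalMeasure, integral_smul_measure, (integral_sum_dirac s _).2]
  simp

end MomentLimits

/-! ### Continuity of cumulants and closedness of real-rootedness -/

section Continuity

theorem tendsto_coeff_mk_pow {m : ℕ → ℕ → ℝ} {m' : ℕ → ℝ}
    (h : ∀ n, Tendsto (fun k => m k n) atTop (𝓝 (m' n))) (j n : ℕ) :
    Tendsto (fun k => PowerSeries.coeff n (PowerSeries.mk (m k) ^ j)) atTop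
      (𝓝 (PowerSeries.coeff n (PowerSeries.mk m' ^ j))) := by
  induction j generalizing n with
  | zero => simpa only [pow_zero] using tendsto_const_nhds
  | succ j ih =>
    simp only [pow_succ, PowerSeries.coeff_mul, PowerSeries.coeff_mk]
    exact tendsto_finsetSum _ fun x _ => (ih x.1).mul (h x.2)

theorem tendsto_freeCumulantSeq {m : ℕ → ℕ → ℝ} {m' : ℕ → ℝ} (h0 : ∀ k, m k 0 = 1) (h0' : m' 0 = 1)
    (h : ∀ n, Tendsto (fun k => m k n) atTop (𝓝 (m' n))) {n : ℕ} (hn : 1 ≤ n) :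
    Tendsto (fun k => freeCumulantSeq (m k) n) atTop (𝓝 (freeCumulantSeq m' n)) := by
  induction n using Nat.strong_induction_on with
  | _ n ih =>
  rw [freeCumulantSeq_eq m' h0' hn]
  simp only [fun k => freeCumulantSeq_eq (m k) (h0 k) hn]
  refine (h n).sub (tendsto_finsetSum _ fun j hj => ?_)
  have := Finset.mem_Ico.1 hj
  exact (ih j this.2 this.1).mul (tendsto_coeff_mk_pow h j (n - j))

theorem tendsto_cumulantCoeff (d : ℕ) {κ : ℕ → ℕ → ℝ} {κ' : ℕ → ℝ}
    (h : ∀ n, 1 ≤ n → Tendsto (fun k => κ k n) atTop (𝓝 (κ' n))) (n : ℕ) :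
    Tendsto (fun k => cumulantCoeff d (κ k) n) atTop (𝓝 (cumulantCoeff d κ' n)) := by
  induction n using Nat.strong_induction_on with
  | _ n ih =>
  cases n with
  | zero => simpa only [cumulantCoeff_zero] using tendsto_const_nhds
  | succ n =>
    simp only [cumulantCoeff_succ]
    refine (tendsto_finsetSum _ fun j _ => ?_).neg.div_const _
    exact ((h (j + 1) (by omega)).div_const _).mul (ih (n - j) (by omega))

/-- The degree is fixed, so convergence of cumulants gives pointwise convergence of the polynomials,
and the lower bound `|Im z|^d` persists in the limit. -/
theorem splits_cumulantPoly_of_tendsto (d : ℕ) {κ : ℕ → ℕ → ℝ} {κ' : ℕ → ℝ}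
    (h : ∀ n, 1 ≤ n → Tendsto (fun k => κ k n) atTop (𝓝 (κ' n)))
    (hs : ∀ k, (cumulantPoly d (κ k)).Splits) : (cumulantPoly d κ').Splits := by
  have hlim : ∀ z : ℂ, Tendsto (fun k => aeval z (cumulantPoly d (κ k))) atTop
      (𝓝 (aeval z (cumulantPoly d κ'))) := by
    intro z
    simp only [cumulantPoly, map_sum, aeval_monomial]
    refine tendsto_finsetSum _ fun j _ => Tendsto.mul_const _ ?_
    exact (Complex.continuous_ofReal.tendsto _).comp ((tendsto_cumulantCoeff d h j).mul_const _)
  refine splits_of_forall_not_im_pos (monic_cumulantPoly d κ').ne_zero fun z hz h0 => ?_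
  have hle : |z.im| ^ d ≤ ‖aeval z (cumulantPoly d κ')‖ := by
    refine ge_of_tendsto' (hlim z).norm fun k => ?_
    have := abs_im_pow_le_norm_aeval (monic_cumulantPoly d (κ k)) (hs k) z
    rwa [natDegree_cumulantPoly] at this
  rw [h0, norm_zero] at hle
  have : 0 < |z.im| ^ d := pow_pos (abs_pos.2 hz.ne') d
  linarith

end Continuity

/-! ### Existence and closure results -/

theorem realMoment_zero {μ : Measure ℝ} (hμ : HasAllMoments μ) : realMoment μ 0 = 1 := by
  have := hμ.1
  simp [realMoment]

/-- A sequence is the free cumulant sequence of a measure if it gives real-rooted polynomials in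
infinitely many degrees. -/
theorem exists_freeCumulant_eq {S : Set ℕ} (hS : S.Infinite) {κ : ℕ → ℝ}
    (hκ : ∀ d ∈ S, (cumulantPoly d κ).Splits) :
    ∃ ρ, HasAllMoments ρ ∧ ∀ n, 1 ≤ n → freeCumulant ρ n = κ n := by
  -- Choosing degrees larger than j makes them tend to infinity and also avoids d = 0, for which
  -- there is no root distribution.
  have hd : ∀ j : ℕ, ∃ d ∈ S, j < d := fun j => hS.exists_gt j
  choose d hdS hdj using hd
  have hlim : Tendsto d atTop atTop :=
    tendsto_atTop_mono (fun j => (hdj j).le) tendsto_id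
  have hd0 : ∀ j, d j ≠ 0 := fun j => by have := hdj j; omega
  have hs := fun j => hκ (d j) (hdS j)
  have hcard : ∀ j, (cumulantPoly (d j) κ).roots.card = d j := fun j => by
    rw [← (hs j).natDegree_eq_card_roots, natDegree_cumulantPoly]
  obtain ⟨ρ, hρ, hρm⟩ := exists_hasAllMoments_of_tendsto
    (μ := fun j => empiricalMeasure (cumulantPoly (d j) κ).roots)
    (c := fun m => ncNumber κ m 0)
    (fun j => hasAllMoments_empiricalMeasure (by rw [hcard]; exact hd0 j))
    (fun m => by
      simp only [realMoment_empiricalMeasure, hcard]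
      exact tendsto_root_moments hlim hd0 κ hs m)
  refine ⟨ρ, hρ, fun n hn => ?_⟩
  rw [freeCumulant, show realMoment ρ = fun m => ncNumber κ m 0 from funext hρm,
    freeCumulantSeq_ncNumber κ hn]

theorem splits_cumulantPoly_of_isFreeAddConv {μ ν ρ : Measure ℝ} {d : ℕ}
    (h : (cumulantPoly d (freeCumulant μ)).Splits) (h' : (cumulantPoly d (freeCumulant ν)).Splits)
    (hρ : IsFreeAddConv μ ν ρ) : (cumulantPoly d (freeCumulant ρ)).Splits := by
  rw [cumulantPoly_congr (κ' := freeCumulant μ + freeCumulant ν) hρ.2]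
  exact splits_cumulantPoly_add h h'

theorem exists_isFreeAddConv {S₁ S₂ : Set ℕ} (hS : (S₁ ∩ S₂).Infinite) {μ ν : Measure ℝ}
    (hμ : μ ∈ realRootedLimits S₁) (hν : ν ∈ realRootedLimits S₂) :
    ∃ ρ, IsFreeAddConv μ ν ρ := by
  rw [mem_realRootedLimits_iff] at hμ hν
  exact exists_freeCumulant_eq hS (κ := freeCumulant μ + freeCumulant ν)
    fun d hd => splits_cumulantPoly_add (hμ.2 d hd.1) (hν.2 d hd.2)

theorem IsFreeAddConv.mem_realRootedLimits {S₁ S₂ : Set ℕ} {μ ν ρ : Measure ℝ}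
    (hμ : μ ∈ realRootedLimits S₁) (hν : ν ∈ realRootedLimits S₂) (hρ : IsFreeAddConv μ ν ρ) :
    ρ ∈ realRootedLimits (S₁ ∩ S₂) := by
  rw [mem_realRootedLimits_iff] at hμ hν ⊢
  exact ⟨hρ.1, fun d hd =>
    splits_cumulantPoly_of_isFreeAddConv (hμ.2 d hd.1) (hν.2 d hd.2) hρ⟩

theorem isFreeAddConv_freeAddConv {μ ν : Measure ℝ} (h : ∃ ρ, IsFreeAddConv μ ν ρ) :
    IsFreeAddConv μ ν (freeAddConv μ ν) := by
  rw [freeAddConv, dif_pos h]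
  exact h.choose_spec

theorem mem_realRootedLimits_of_tendsto {S : Set ℕ} {μs : ℕ → Measure ℝ}
    (hμs : ∀ k, μs k ∈ realRootedLimits S) {μ : Measure ℝ} (hμ : HasAllMoments μ)
    (h : ∀ n : ℕ, 1 ≤ n →
      Tendsto (fun k => realMoment (μs k) n) atTop (𝓝 (realMoment μ n))) :
    μ ∈ realRootedLimits S := by
  simp only [mem_realRootedLimits_iff] at hμs ⊢
  refine ⟨hμ, fun d hd => splits_cumulantPoly_of_tendsto d
    (κ := fun k => freeCumulant (μs k)) (fun n hn => ?_) fun k => (hμs k).2 d hd⟩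
  refine tendsto_freeCumulantSeq (m := fun k => realMoment (μs k))
    (fun k => realMoment_zero (hμs k).1) (realMoment_zero hμ) (fun n => ?_) hn
  rcases Nat.eq_zero_or_pos n with rfl | hn
  · simp only [realMoment_zero hμ, fun k => realMoment_zero (hμs k).1]
    exact tendsto_const_nhds
  · exact h n hn

theorem mainTheorem11 :
    (∀ S₁ S₂ : Set ℕ, (S₁ ∩ S₂).Infinite →
      ∀ μ ∈ realRootedLimits S₁, ∀ ν ∈ realRootedLimits S₂,
        IsFreeAddConv μ ν (freeAddConv μ ν) ∧
        freeAddConv μ ν ∈ realRootedLimits (S₁ ∩ S₂) ∧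
        ∀ ρ : Measure ℝ, IsFreeAddConv μ ν ρ → ρ ∈ realRootedLimits (S₁ ∩ S₂)) ∧
    (∀ S : Set ℕ, S.Infinite → ∀ μ ∈ realRootedLimits S, ∀ ν ∈ realRootedLimits S,
      freeAddConv μ ν ∈ realRootedLimits S) ∧
    (∀ S : Set ℕ, S.Infinite → ∀ μs : ℕ → Measure ℝ, (∀ k, μs k ∈ realRootedLimits S) →
      ∀ μ : Measure ℝ, HasAllMoments μ →
        (∀ n : ℕ, 1 ≤ n → Tendsto (fun k => realMoment (μs k) n) atTop (𝓝 (realMoment μ n))) →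
        μ ∈ realRootedLimits S) := by
  refine ⟨fun S₁ S₂ hS μ hμ ν hν => ?_, fun S hS μ hμ ν hν => ?_,
    fun S _ μs hμs μ hμ h => mem_realRootedLimits_of_tendsto hμs hμ h⟩
  · have hconv := isFreeAddConv_freeAddConv (exists_isFreeAddConv hS hμ hν)
    exact ⟨hconv, hconv.mem_realRootedLimits hμ hν, fun ρ hρ => hρ.mem_realRootedLimits hμ hν⟩
  · have hSS : (S ∩ S).Infinite := by rwa [Set.inter_self]
    have hconv := isFreeAddConv_freeAddConv (exists_isFreeAddConv hSS hμ hν)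
    simpa only [Set.inter_self] using hconv.mem_realRootedLimits hμ hν
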